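/- **Model.** Let $N,J\ge 1$ and $K\ge 0$ be integers, let $f$ be a link function and $C>0$ a constant. Fixed (non-random) true parameters are a matrix $\Theta^*\in\mathbb R^{N\times K}$ with rows $\boldsymbol\theta_i^*$, a matrix $A^*\in\mathbb R^{J\times K}$ with rows $\mathbf a_j^*$, and a vector $\mathbf d^*\in\mathbb R^J$. The responses $Y_{ij}\in\{0,1\}$ satisfy $P(Y_{ij}=1)=f(d_j^*+(\mathbf a_j^*)^\top\boldsymbol\theta_i^*)$, the indicators $W_{ij}\in\{0,1\}$ say whether $Y_{ij}$ is observed ($W_{ij}=1$) or missing ($W_{ij}=0$), and all the variables $Y_{ij},W_{ij}$ $(1\le i\le N,\ 1\le j\le J)$ are mutually independent. A constrained joint maximum likelihood estimate (CJMLE) $(\hat\Theta,\hat A,\hat{\mathbf d})$ is a maximizer of the log-likelihood of the observed entries $$\log\prod_{i,j:\,W_{ij}=1} f(d_j+\mathbf a_j^\top\boldsymbol\theta_i)^{Y_{ij}}\bigl(1-f(d_j+\mathbf a_j^\top\boldsymbol\theta_i)\bigr)^{1-Y_{ij}}$$ over all $(\Theta,A,\mathbf d)$ with $\sqrt{1+\|\boldsymbol\theta_i\|^2}\le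 C$ and $\sqrt{d_j^2+\|\mathbf a_j\|^2}\le C$ for all $i,j$, where $\|\cdot\|$ is the Euclidean norm. It exists but need not be unique. **Assumptions.** - (A1) $\sqrt{1+\|\boldsymbol\theta_i^*\|^2}\le C$ and $\sqrt{(d_j^*)^2+\|\mathbf a_j^*\|^2}\le C$ for all $i,j$. - (A2) $f$ is differentiable, $0<f(x)<1$ and $f'(x)\neq 0$ for $|x|\le C^2$, and $$\sup_{|x|\le C^2}\frac{|f'(x)|}{f(x)(1-f(x))}<\infty,\qquad \sup_{|x|\le C^2}\frac{f(x)(1-f(x))}{(f'(x))^2}<\infty.$$ - (A5) The $W_{ij}$ are i.i.d. Bernoulli with $P(W_{ij}=1)=\frac{n}{NJ}$ for some real $n>0$. **Theorem.** Let $C>0$ and let $f$ satisfy (A2). There are constants $C_1,C_2>0$, depending only on $C$ and $f$ (in particular not on $N$, $J$, $K$, $n$ or the true parameters), such that, whenever (A1) and (A5) hold and $n\ge (N+J)\log(JN)$, a CJMLE exists for every realization of the data and, with probability at least $1-C_1/(N+J)$, every CJMLE satisfies $$\frac{1}{NJ}\bigl\|\hat\Theta\hat A^\top+\mathbf 1_N\hat{\mathbf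 d}^\top-\Theta^*(A^*)^\top-\mathbf 1_N{\mathbf d^*}^\top\bigr\|_F^2\le C_2\sqrt{\frac{J+N}{n}},$$ where $\mathbf 1_N$ is the all-ones vector in $\mathbb R^N$ and $\|\cdot\|_F$ is the Frobenius norm. -/

import Mathlib

open MeasureTheory ProbabilityTheory
open scoped Matrix Matrix.Norms.Frobenius

noncomputable section

namespace IFA

/-- The `N × J` matrix `Θ Aᵀ + 1_N dᵀ`, whose `(i, j)` entry is `d_j + a_jᵀ θ_i`
(`θ_i` is row `i` of `Θ`, `a_j` is row `j` of `A`). -/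
def scoreMatrix {N J K : ℕ} (Θ : Matrix (Fin N) (Fin K) ℝ) (A : Matrix (Fin J) (Fin K) ℝ)
    (d : Fin J → ℝ) : Matrix (Fin N) (Fin J) ℝ :=
  Θ * Aᵀ + Matrix.vecMulVec (1 : Fin N → ℝ) d

/-- The norm constraints on the parameters:
`√(1 + ‖θ_i‖²) ≤ C` for all `i` and `√(d_j² + ‖a_j‖²) ≤ C` for all `j` (Euclidean norms). -/
def Feasible (C : ℝ) {N J K : ℕ} (Θ : Matrix (Fin N) (Fin K) ℝ) (A : Matrix (Fin J) (Fin K) ℝ)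
    (d : Fin J → ℝ) : Prop :=
  (∀ i, √(1 + ‖WithLp.toLp 2 (Θ i)‖ ^ 2) ≤ C) ∧
    ∀ j, √(d j ^ 2 + ‖WithLp.toLp 2 (A j)‖ ^ 2) ≤ C

/-- Regularity of the link function: `f` is differentiable and the suprema over `|x| ≤ C²` of
`|f'| / (f (1 - f))` and of `f (1 - f) / (f')²` are finite. That the denominators do not vanish
is stated explicitly, because division by zero is zero in Lean. -/
structure LinkRegular (C : ℝ) (f : ℝ → ℝ) : Prop where
  differentiable : Differentiable ℝ f
  mem_Ioo : ∀ x, |x| ≤ C ^ 2 → f x ∈ Set.Ioo (0 : ℝ) 1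
  deriv_ne_zero : ∀ x, |x| ≤ C ^ 2 → deriv f x ≠ 0
  bddAbove_left : BddAbove ((fun x => |deriv f x| / (f x * (1 - f x))) '' {x | |x| ≤ C ^ 2})
  bddAbove_right : BddAbove ((fun x => f x * (1 - f x) / deriv f x ^ 2) '' {x | |x| ≤ C ^ 2})

/-- The joint likelihood of the observed entries: the product over the pairs `(i, j)` with
`w i j = 1` of `f(m)^y (1 - f(m))^(1 - y)`, where `m = d_j + a_jᵀ θ_i` and `y = y i j`.
The values `0` and `1` of `y` and `w` are encoded as `false` and `true`. -/
def likelihood (f : ℝ → ℝ) {N J K : ℕ} (y w : Fin N → Fin J → Bool)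
    (Θ : Matrix (Fin N) (Fin K) ℝ) (A : Matrix (Fin J) (Fin K) ℝ) (d : Fin J → ℝ) : ℝ :=
  ∏ p : Fin N × Fin J with w p.1 p.2 = true,
    if y p.1 p.2 = true then f (d p.2 + A p.2 ⬝ᵥ Θ p.1) else 1 - f (d p.2 + A p.2 ⬝ᵥ Θ p.1)

/-- `(Θ, A, d)` is a constrained joint maximum likelihood estimate from the data `(y, w)`: it
maximizes the joint log-likelihood of the observed entries under the norm constraints. -/
def IsCJMLE (C : ℝ) (f : ℝ → ℝ) {N J K : ℕ} (y w : Fin N → Fin J → Bool)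
    (Θ : Matrix (Fin N) (Fin K) ℝ) (A : Matrix (Fin J) (Fin K) ℝ) (d : Fin J → ℝ) : Prop :=
  Feasible C Θ A d ∧
    ∀ (Θ' : Matrix (Fin N) (Fin K) ℝ) (A' : Matrix (Fin J) (Fin K) ℝ) (d' : Fin J → ℝ),
      Feasible C Θ' A' d' →
        Real.log (likelihood f y w Θ' A' d') ≤ Real.log (likelihood f y w Θ A d)

/-- The data-generating model with true parameters `Θ, A, d`: responses `Y i j` are Bernoulli with
success probability `f (d_j + a_jᵀ θ_i)`, observation indicators `W i j` are Bernoulli with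
success probability `n / (N J)`, and all these variables are mutually independent. -/
structure IsModel (f : ℝ → ℝ) {N J K : ℕ} (n : ℝ) (Θ : Matrix (Fin N) (Fin K) ℝ)
    (A : Matrix (Fin J) (Fin K) ℝ) (d : Fin J → ℝ) {Ω : Type*} [MeasurableSpace Ω]
    (P : Measure Ω) (Y W : Fin N → Fin J → Ω → Bool) : Prop where
  measurable_Y : ∀ i j, Measurable (Y i j)
  measurable_W : ∀ i j, Measurable (W i j)
  prob_Y : ∀ i j, P.real {ω | Y i j ω = true} = f (d j + A j ⬝ᵥ Θ i)
  prob_W : ∀ i j, P.real {ω | W i j ω = true} = n / (N * J)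
  indep : iIndepFun
    (Sum.elim (fun p : Fin N × Fin J => Y p.1 p.2) (fun p : Fin N × Fin J => W p.1 p.2)) P

end IFA

end

/-! The estimate has likelihood at least that of the truth, so the log-likelihood ratio is
nonnegative there. Its mean is minus a sum of Bernoulli Kullback-Leibler divergences over the
entries, at most `-c * n/(NJ)` times the squared Frobenius error
(`LinkRegular.exists_kl_lower_bound`). A large error therefore forces the centred log-likelihood
ratio to be large at some feasible parameter, and it remains to bound that process uniformly, at
scale `√((J+N)/n) * n`.

The bound comes from an exponential moment of the supremum (`exp_iSup_centred_le`). Symmetrization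
and contraction, one entry at a time, replace the log-likelihood terms by random coefficients times
the score differences. Score matrices of feasible parameters are Gram matrices of vectors of norm at
most `C`, in any dimension, so Grothendieck's inequality reduces the supremum to the `2^(N+J)` pairs
of sign vectors, and no constant depends on `K`. For one pair the moment factors over the entries.
Each factor is `1` plus a multiple of the observation probability, because unobserved entries
contribute nothing. A Chernoff bound then pays for the `2^(N+J)` pairs and leaves a failure
probability `exp(-(N+J))`.

The logarithm in the assumption on `n` serves only to give `N + J ≤ n`. -/

noncomputable section

/-! ### Grothendieck's inequality, by Rademacher sums and truncation -/

/-- The sign `±1` encoded by a Boolean. -/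
def boolSign (b : Bool) : ℝ := if b then 1 else -1

lemma boolSign_true : boolSign true = 1 := rfl

lemma boolSign_false : boolSign false = -1 := rfl

lemma exists_sum_mul_le_boolSign {ι : Type*} [Fintype ι] {M : ℝ} (a c : ι → ℝ)
    (ha : ∀ i, |a i| ≤ M) : ∃ x : ι → Bool, ∑ i, a i * c i ≤ M * ∑ i, boolSign (x i) * c i := by
  refine ⟨fun i => decide (0 ≤ c i), ?_⟩
  rw [Finset.mul_sum]
  refine Finset.sum_le_sum fun i _ => ?_
  have h := abs_le.1 (ha i)
  by_cases hc : 0 ≤ c i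
  · simp only [hc, decide_true, boolSign_true]
    nlinarith
  · simp only [hc, decide_false, boolSign_false]
    nlinarith

/-- A bilinear form on a product of cubes is maximal at vertices: freeze one variable, move the
other to a vertex, and exchange the roles. -/
lemma bilin_le_of_boolSign_le {ι κ : Type*} [Fintype ι] [Fintype κ] {E : ι → κ → ℝ} {M S : ℝ}
    (hM : 0 ≤ M)
    (hS : ∀ (x : ι → Bool) (y : κ → Bool), ∑ i, ∑ j, E i j * (boolSign (x i) * boolSign (y j)) ≤ S)
    (a : ι → ℝ) (b : κ → ℝ) (ha : ∀ i, |a i| ≤ M) (hb : ∀ j, |b j| ≤ M) :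
    ∑ i, ∑ j, E i j * (a i * b j) ≤ M ^ 2 * S := by
  obtain ⟨x, hx⟩ := exists_sum_mul_le_boolSign a (fun i => ∑ j, E i j * b j) ha
  obtain ⟨y, hy⟩ := exists_sum_mul_le_boolSign b (fun j => ∑ i, E i j * boolSign (x i)) hb
  have h1 : ∑ i, ∑ j, E i j * (a i * b j) = ∑ i, a i * ∑ j, E i j * b j := by
    refine Finset.sum_congr rfl fun i _ => ?_
    rw [Finset.mul_sum]
    exact Finset.sum_congr rfl fun j _ => by ring
  have h2 : ∑ i, boolSign (x i) * ∑ j, E i j * b j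
      = ∑ j, b j * ∑ i, E i j * boolSign (x i) := by
    simp_rw [Finset.mul_sum]
    rw [Finset.sum_comm]
    exact Finset.sum_congr rfl fun j _ => Finset.sum_congr rfl fun i _ => by ring
  have h3 : ∑ j, boolSign (y j) * ∑ i, E i j * boolSign (x i)
      = ∑ i, ∑ j, E i j * (boolSign (x i) * boolSign (y j)) := by
    simp_rw [Finset.mul_sum]
    rw [Finset.sum_comm]
    exact Finset.sum_congr rfl fun j _ => Finset.sum_congr rfl fun i _ => by ring
  have h4 := hS x y
  calc _ ≤ M * ∑ i, boolSign (x i) * ∑ j, E i j * b j := h1 ▸ hx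
    _ ≤ M * (M * S) := by
      rw [h2]
      refine mul_le_mul_of_nonneg_left (hy.trans ?_) hM
      rw [h3]
      exact mul_le_mul_of_nonneg_left h4 hM
    _ = M ^ 2 * S := by ring

lemma sum_fin_cons {S : Type*} [Fintype S] {k : ℕ} (F : (Fin (k + 1) → S) → ℝ) :
    ∑ σ, F σ = ∑ s, ∑ σ : Fin k → S, F (Fin.cons s σ) := by
  rw [← (Fin.consEquiv fun _ : Fin (k + 1) => S).sum_comp, Fintype.sum_prod_type]
  rfl

/-- The signed sum `∑ ± u k` with signs `σ`. -/
def signedSum {k : ℕ} (u : Fin k → ℝ) (σ : Fin k → Bool) : ℝ := ∑ l, boolSign (σ l) * u l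

lemma signedSum_cons {k : ℕ} (u : Fin (k + 1) → ℝ) (b : Bool) (σ : Fin k → Bool) :
    signedSum u (Fin.cons b σ) = boolSign b * u 0 + signedSum (fun l => u l.succ) σ := by
  simp [signedSum, Fin.sum_univ_succ]

/-- Rademacher signs are orthonormal, so `u ↦ signedSum u` embeds `ℝ^k` isometrically into `L²` of
the uniform law on sign patterns. This turns inner products of vectors into averages of products of
scalars. -/
lemma sum_signedSum_mul : ∀ {k : ℕ} (u v : Fin k → ℝ),
    ∑ σ, signedSum u σ * signedSum v σ = 2 ^ k * ∑ l, u l * v l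
  | 0, u, v => by simp [signedSum]
  | k + 1, u, v => by
    rw [sum_fin_cons, Fintype.sum_bool, ← Finset.sum_add_distrib]
    have h : ∀ σ : Fin k → Bool,
        signedSum u (Fin.cons true σ) * signedSum v (Fin.cons true σ)
          + signedSum u (Fin.cons false σ) * signedSum v (Fin.cons false σ)
        = 2 * (u 0 * v 0) + 2 *
          (signedSum (fun l => u l.succ) σ * signedSum (fun l => v l.succ) σ) := by
      intro σ
      simp only [signedSum_cons, boolSign_true, boolSign_false]
      ring
    rw [Finset.sum_congr rfl fun σ _ => h σ, Finset.sum_add_distrib,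
      ← Finset.mul_sum Finset.univ (fun σ => signedSum _ σ * signedSum _ σ),
      sum_signedSum_mul, Fin.sum_univ_succ]
    simp
    ring

/-- Khintchine's fourth-moment bound: odd powers of the first sign cancel, and induction handles the
rest. It controls the part of a signed sum lost by truncation. -/
lemma sum_signedSum_pow_four_le : ∀ {k : ℕ} (u : Fin k → ℝ),
    ∑ σ, signedSum u σ ^ 4 ≤ 2 ^ k * (3 * (∑ l, u l ^ 2) ^ 2)
  | 0, u => by simp [signedSum]
  | k + 1, u => by
    rw [sum_fin_cons, Fintype.sum_bool, ← Finset.sum_add_distrib]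
    have h : ∀ σ : Fin k → Bool,
        signedSum u (Fin.cons true σ) ^ 4 + signedSum u (Fin.cons false σ) ^ 4
        = 2 * u 0 ^ 4 + (12 * u 0 ^ 2) *
          (signedSum (fun l => u l.succ) σ * signedSum (fun l => u l.succ) σ)
          + 2 * signedSum (fun l => u l.succ) σ ^ 4 := by
      intro σ
      simp only [signedSum_cons, boolSign_true, boolSign_false]
      ring
    rw [Finset.sum_congr rfl fun σ _ => h σ, Finset.sum_add_distrib, Finset.sum_add_distrib,
      ← Finset.mul_sum Finset.univ (fun σ => signedSum _ σ * signedSum _ σ),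
      ← Finset.mul_sum Finset.univ (fun σ => signedSum _ σ ^ 4),
      sum_signedSum_mul, Fin.sum_univ_succ]
    have ih := sum_signedSum_pow_four_le fun l : Fin k => u l.succ
    simp only [Finset.sum_const, Finset.card_univ, Fintype.card_pi, Fintype.card_bool,
      Finset.prod_const, Fintype.card_fin, nsmul_eq_mul, Nat.cast_pow, Nat.cast_ofNat, ← sq]
    have h2 : (0 : ℝ) ≤ 2 ^ k * u 0 ^ 4 := by positivity
    rw [pow_succ (2 : ℝ) k]
    linarith

/-- Truncation of a real number to `[-2, 2]`. -/
def truncTwo (x : ℝ) : ℝ := max (-2) (min 2 x)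

lemma abs_truncTwo_le (x : ℝ) : |truncTwo x| ≤ 2 := by
  rw [abs_le]
  exact ⟨le_max_left _ _, max_le (by norm_num) (min_le_left _ _)⟩

lemma truncTwo_sq_le (x : ℝ) : truncTwo x ^ 2 ≤ x * x := by
  unfold truncTwo
  rcases le_total x (-2) with h | h
  · rw [min_eq_right (by linarith), max_eq_left h]; nlinarith
  · rcases le_total x 2 with h' | h'
    · rw [min_eq_right h', max_eq_right h]; nlinarith
    · rw [min_eq_left h', max_eq_right (by norm_num)]; nlinarith

/-- By AM-GM, `4y ≤ (y + 2)²/2` for the excess `y` over level `2`. With the fourth-moment constant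
`3`, the excess magnified by `4` has mean square at most `3/4`, so it still lies in the unit ball.
-/
lemma sub_truncTwo_sq_le (x : ℝ) : (4 * (x - truncTwo x)) ^ 2 ≤ x ^ 4 / 4 := by
  have key : ∀ y : ℝ, 0 ≤ y → (4 * y) ^ 2 ≤ (y + 2) ^ 4 / 4 := by
    intro y hy
    have h1 : 4 * y ≤ (y + 2) ^ 2 / 2 := by nlinarith [sq_nonneg (y - 2)]
    calc (4 * y) ^ 2 ≤ ((y + 2) ^ 2 / 2) ^ 2 := by gcongr
      _ = _ := by ring
  unfold truncTwo
  rcases le_total x (-2) with h | h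
  · rw [min_eq_right (by linarith), max_eq_left h]
    calc (4 * (x - -2)) ^ 2 = (4 * (-x - 2)) ^ 2 := by ring
      _ ≤ _ := key _ (by linarith)
      _ = _ := by ring
  · rcases le_total x 2 with h' | h'
    · rw [min_eq_right h', max_eq_right h, sub_self]
      simp only [mul_zero, ne_eq, OfNat.ofNat_ne_zero, not_false_eq_true, zero_pow]
      positivity
    · rw [min_eq_left h', max_eq_right (by norm_num)]
      calc _ ≤ _ := key (x - 2) (by linarith)
        _ = _ := by ring

/-- Write `XZ` as truncated times truncated, plus excess times `Z`, plus truncated times excess. The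
first product is bounded by `2`-cubes, hence by `4S`; each of the others is a quarter of an
admissible configuration, hence at most `c/4`. -/
lemma grothendieck_halving {ι κ : Type*} [Fintype ι] [Fintype κ] {E : ι → κ → ℝ} {S c : ℝ}
    (hS : ∀ (x : ι → Bool) (y : κ → Bool), ∑ i, ∑ j, E i j * (boolSign (x i) * boolSign (y j)) ≤ S)
    (hc : ∀ (k : ℕ) (u : ι → Fin k → ℝ) (v : κ → Fin k → ℝ), (∀ i, ∑ l, u i l ^ 2 ≤ 1) →
      (∀ j, ∑ l, v j l ^ 2 ≤ 1) → ∑ i, ∑ j, E i j * ∑ l, u i l * v j l ≤ c)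
    (k : ℕ) (u : ι → Fin k → ℝ) (v : κ → Fin k → ℝ) (hu : ∀ i, ∑ l, u i l ^ 2 ≤ 1)
    (hv : ∀ j, ∑ l, v j l ^ 2 ≤ 1) :
    ∑ i, ∑ j, E i j * ∑ l, u i l * v j l ≤ 4 * S + c / 2 := by
  have h2k : (0 : ℝ) < 2 ^ k := by positivity
  -- The new vectors are indexed by the `2^k` sign patterns, which is why `hc` must cover every
  -- dimension.
  have hc' : ∀ (X : ι → (Fin k → Bool) → ℝ) (Z : κ → (Fin k → Bool) → ℝ),
      (∀ i, ∑ σ, X i σ ^ 2 ≤ 2 ^ k) → (∀ j, ∑ σ, Z j σ ^ 2 ≤ 2 ^ k) →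
      ∑ i, ∑ j, E i j * ∑ σ, X i σ * Z j σ ≤ 2 ^ k * c := by
    intro X Z hX hZ
    let e := Fintype.equivFin (Fin k → Bool)
    have hs : √((2 : ℝ) ^ k) ^ 2 = 2 ^ k := Real.sq_sqrt h2k.le
    have hs0 : √((2 : ℝ) ^ k) ≠ 0 := by positivity
    have h := hc _ (fun i l => X i (e.symm l) / √(2 ^ k)) (fun j l => Z j (e.symm l) / √(2 ^ k))
      (fun i => by
        rw [e.symm.sum_comp (fun σ => (X i σ / √(2 ^ k)) ^ 2)]
        simp_rw [div_pow, hs]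
        rw [← Finset.sum_div, div_le_one h2k]
        exact hX i)
      (fun j => by
        rw [e.symm.sum_comp (fun σ => (Z j σ / √(2 ^ k)) ^ 2)]
        simp_rw [div_pow, hs]
        rw [← Finset.sum_div, div_le_one h2k]
        exact hZ j)
    have h' : ∀ i j, ∑ l, X i (e.symm l) / √(2 ^ k) * (Z j (e.symm l) / √(2 ^ k))
        = (∑ σ, X i σ * Z j σ) / 2 ^ k := by
      intro i j
      rw [e.symm.sum_comp (fun σ => X i σ / √(2 ^ k) * (Z j σ / √(2 ^ k))), Finset.sum_div]
      refine Finset.sum_congr rfl fun σ _ => ?_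
      rw [div_mul_div_comm, ← sq, hs]
    simp_rw [h', ← mul_div_assoc, ← Finset.sum_div] at h
    rw [div_le_iff₀ h2k] at h
    linarith
  set X : ι → (Fin k → Bool) → ℝ := fun i => signedSum (u i) with hX
  set Z : κ → (Fin k → Bool) → ℝ := fun j => signedSum (v j) with hZ
  have sq_le : ∀ w : Fin k → ℝ, ∑ l, w l ^ 2 ≤ 1 →
      ∑ σ, signedSum w σ * signedSum w σ ≤ 2 ^ k := by
    intro w hw
    rw [sum_signedSum_mul]
    simp_rw [← sq]
    exact mul_le_of_le_one_right h2k.le hw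
  have trunc_le : ∀ w : Fin k → ℝ, ∑ l, w l ^ 2 ≤ 1 →
      ∑ σ, truncTwo (signedSum w σ) ^ 2 ≤ 2 ^ k := fun w hw =>
    (Finset.sum_le_sum fun σ _ => truncTwo_sq_le _).trans (sq_le w hw)
  have tail_le : ∀ w : Fin k → ℝ, ∑ l, w l ^ 2 ≤ 1 →
      ∑ σ, (4 * (signedSum w σ - truncTwo (signedSum w σ))) ^ 2 ≤ 2 ^ k := by
    intro w hw
    have h4 := sum_signedSum_pow_four_le w
    have h0 : 0 ≤ ∑ l, w l ^ 2 := Finset.sum_nonneg fun l _ => sq_nonneg _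
    have h1 : (∑ l, w l ^ 2) ^ 2 ≤ 1 := pow_le_one₀ h0 hw
    calc _ ≤ ∑ σ, signedSum w σ ^ 4 / 4 := Finset.sum_le_sum fun σ _ => sub_truncTwo_sq_le _
      _ = (∑ σ, signedSum w σ ^ 4) / 4 := by rw [Finset.sum_div]
      _ ≤ 2 ^ k := by nlinarith
  have t1 := hc' (fun i σ => 4 * (X i σ - truncTwo (X i σ))) Z (fun i => tail_le _ (hu i))
    (fun j => by simpa [sq] using sq_le _ (hv j))
  have t2 := hc' (fun i σ => truncTwo (X i σ)) (fun j σ => 4 * (Z j σ - truncTwo (Z j σ)))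
    (fun i => trunc_le _ (hu i)) (fun j => tail_le _ (hv j))
  have t0 : ∑ i, ∑ j, E i j * ∑ σ, truncTwo (X i σ) * truncTwo (Z j σ) ≤ 2 ^ k * (4 * S) := by
    have hh : ∀ σ, ∑ i, ∑ j, E i j * (truncTwo (X i σ) * truncTwo (Z j σ)) ≤ 4 * S := fun σ => by
      have := bilin_le_of_boolSign_le (M := 2) (by norm_num) hS (fun i => truncTwo (X i σ))
        (fun j => truncTwo (Z j σ)) (fun i => abs_truncTwo_le _) (fun j => abs_truncTwo_le _)
      linarith
    have := Finset.sum_le_sum fun σ (_ : σ ∈ Finset.univ) => hh σ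
    simp only [Finset.sum_const, Finset.card_univ, Fintype.card_pi, Fintype.card_bool,
      Finset.prod_const, Fintype.card_fin, nsmul_eq_mul, Nat.cast_pow, Nat.cast_ofNat] at this
    refine le_trans (le_of_eq (Eq.symm ?_)) this
    rw [Finset.sum_comm]
    refine Finset.sum_congr rfl fun i _ => ?_
    rw [Finset.sum_comm]
    exact Finset.sum_congr rfl fun j _ => by rw [Finset.mul_sum]
  have hsum : 2 ^ k * ∑ i, ∑ j, E i j * ∑ l, u i l * v j l
      = ∑ i, ∑ j, E i j * ∑ σ, truncTwo (X i σ) * truncTwo (Z j σ)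
        + (∑ i, ∑ j, E i j * ∑ σ, 4 * (X i σ - truncTwo (X i σ)) * Z j σ) / 4
        + (∑ i, ∑ j, E i j * ∑ σ, truncTwo (X i σ) * (4 * (Z j σ - truncTwo (Z j σ)))) / 4 := by
    have hij : ∀ i j, 2 ^ k * ∑ l, u i l * v j l
        = ∑ σ, truncTwo (X i σ) * truncTwo (Z j σ)
          + (∑ σ, 4 * (X i σ - truncTwo (X i σ)) * Z j σ) / 4
          + (∑ σ, truncTwo (X i σ) * (4 * (Z j σ - truncTwo (Z j σ)))) / 4 := by
      intro i j
      rw [← sum_signedSum_mul, Finset.sum_div, Finset.sum_div, ← Finset.sum_add_distrib,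
        ← Finset.sum_add_distrib]
      refine Finset.sum_congr rfl fun σ _ => ?_
      simp only [hX, hZ]
      ring
    rw [Finset.mul_sum, Finset.sum_div, Finset.sum_div, ← Finset.sum_add_distrib,
      ← Finset.sum_add_distrib]
    refine Finset.sum_congr rfl fun i _ => ?_
    rw [Finset.mul_sum, Finset.sum_div, Finset.sum_div, ← Finset.sum_add_distrib,
      ← Finset.sum_add_distrib]
    refine Finset.sum_congr rfl fun j _ => ?_
    rw [mul_left_comm, hij]
    ring
  have : 2 ^ k * ∑ i, ∑ j, E i j * ∑ l, u i l * v j l ≤ 2 ^ k * (4 * S + c / 2) := by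
    rw [hsum]; linarith
  exact le_of_mul_le_mul_left this h2k

/-- **Grothendieck's inequality**, with constant `8`. -/
theorem grothendieck_inequality {ι κ : Type*} [Fintype ι] [Fintype κ] {E : ι → κ → ℝ} {S : ℝ}
    (hS : ∀ (x : ι → Bool) (y : κ → Bool), ∑ i, ∑ j, E i j * (boolSign (x i) * boolSign (y j)) ≤ S)
    (k : ℕ) (u : ι → Fin k → ℝ) (v : κ → Fin k → ℝ) (hu : ∀ i, ∑ l, u i l ^ 2 ≤ 1)
    (hv : ∀ j, ∑ l, v j l ^ 2 ≤ 1) :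
    ∑ i, ∑ j, E i j * ∑ l, u i l * v j l ≤ 8 * S := by
  set c : ℝ := ∑ i, ∑ j, |E i j| with hc
  -- Iterating `c ↦ 4S + c/2` from the Cauchy-Schwarz bound `∑ |E i j|` converges to its fixed point
  -- `8S`.
  have key : ∀ r : ℕ, ∀ (k : ℕ) (u : ι → Fin k → ℝ) (v : κ → Fin k → ℝ),
      (∀ i, ∑ l, u i l ^ 2 ≤ 1) → (∀ j, ∑ l, v j l ^ 2 ≤ 1) →
      ∑ i, ∑ j, E i j * ∑ l, u i l * v j l ≤ 8 * S + (1 / 2) ^ r * (c - 8 * S) := by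
    intro r
    induction r with
    | zero =>
      intro k u v hu hv
      simp only [pow_zero, one_mul, add_sub_cancel]
      refine Finset.sum_le_sum fun i _ => Finset.sum_le_sum fun j _ => ?_
      have h1 : |∑ l, u i l * v j l| ≤ 1 := by
        have := Finset.sum_mul_sq_le_sq_mul_sq Finset.univ (u i) (v j)
        have h0 : 0 ≤ ∑ l, v j l ^ 2 := Finset.sum_nonneg fun l _ => sq_nonneg _
        rw [← sq_le_one_iff_abs_le_one]
        exact this.trans (mul_le_one₀ (hu i) h0 (hv j))
      calc _ ≤ |E i j * ∑ l, u i l * v j l| := le_abs_self _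
        _ = |E i j| * |∑ l, u i l * v j l| := abs_mul _ _
        _ ≤ |E i j| := mul_le_of_le_one_right (abs_nonneg _) h1
    | succ r ih =>
      intro k u v hu hv
      refine (grothendieck_halving hS ih k u v hu hv).trans (le_of_eq ?_)
      rw [pow_succ]; ring
  have hlim : Filter.Tendsto (fun r : ℕ => 8 * S + (1 / 2 : ℝ) ^ r * (c - 8 * S)) Filter.atTop
      (nhds (8 * S + 0 * (c - 8 * S))) :=
    ((tendsto_pow_atTop_nhds_zero_of_lt_one (by norm_num) (by norm_num)).mul_const _).const_add _
  rw [zero_mul, add_zero] at hlim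
  exact ge_of_tendsto' hlim fun r => key r k u v hu hv

/-! ### Exponential moments of suprema: contraction, symmetrization, tensorization -/

/-- Weak majorization for the increasing convex function `exp`. In the main case `q ≤ a ≤ p`, expand
`(e^p - e^a)(e^a - e^q) ≥ 0` and use `e^a e^b ≤ e^p e^q`. -/
lemma exp_add_exp_le_of_submajorized {a b p q : ℝ} (ha : a ≤ max p q) (hb : b ≤ max p q)
    (hab : a + b ≤ p + q) : Real.exp a + Real.exp b ≤ Real.exp p + Real.exp q := by
  wlog hqp : q ≤ p generalizing p q
  · rw [add_comm (Real.exp p)]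
    exact this (by rwa [max_comm]) (by rwa [max_comm]) (by linarith) (by linarith)
  rw [max_eq_left hqp] at ha hb
  rcases le_total a q with h | h
  · linarith [Real.exp_le_exp.2 h, Real.exp_le_exp.2 hb]
  · have h1 : Real.exp a * Real.exp b ≤ Real.exp p * Real.exp q := by
      rw [← Real.exp_add, ← Real.exp_add]
      exact Real.exp_le_exp.2 hab
    have h2 := Real.exp_le_exp.2 ha
    have h3 := Real.exp_le_exp.2 h
    have h4 := Real.exp_pos a
    refine le_of_mul_le_mul_left ?_ h4
    nlinarith [mul_nonneg (sub_nonneg.2 h2) (sub_nonneg.2 h3)]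

/-- The contraction principle for one Rademacher sign and the exponential function. -/
lemma exp_iSup_contraction {T : Type*} [Finite T] [Nonempty T] (B φ α : T → ℝ)
    (h0 : ∀ t, |φ t| ≤ |α t|) (h1 : ∀ t s, |φ t - φ s| ≤ |α t - α s|) :
    Real.exp (⨆ t, (B t + φ t)) + Real.exp (⨆ t, (B t - φ t))
      ≤ Real.exp (⨆ t, (B t + α t)) + Real.exp (⨆ t, (B t - α t)) := by
  obtain ⟨t, ht⟩ := exists_eq_ciSup_of_finite (f := fun t => B t + φ t)
  obtain ⟨s, hs⟩ := exists_eq_ciSup_of_finite (f := fun t => B t - φ t)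
  have hp : ∀ r, B r + α r ≤ ⨆ t, (B t + α t) := fun r =>
    le_ciSup (f := fun t => B t + α t) (Set.finite_range _).bddAbove r
  have hq : ∀ r, B r - α r ≤ ⨆ t, (B t - α t) := fun r =>
    le_ciSup (f := fun t => B t - α t) (Set.finite_range _).bddAbove r
  rw [← ht, ← hs]
  have hmax : ∀ r, B r + |α r| ≤ max (⨆ t, (B t + α t)) (⨆ t, (B t - α t)) := by
    intro r
    rcases abs_cases (α r) with ⟨h, -⟩ | ⟨h, -⟩ <;> rw [h]
    · exact (hp r).trans (le_max_left _ _)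
    · exact (hq r).trans (le_max_right _ _)
  refine exp_add_exp_le_of_submajorized ?_ ?_ ?_
  · exact (by linarith [le_abs_self (φ t), h0 t] : _ ≤ B t + |α t|).trans (hmax t)
  · exact (by linarith [neg_abs_le (φ s), h0 s] : _ ≤ B s + |α s|).trans (hmax s)
  -- According to the sign of `α t - α s`, the maximizers `t` and `s` serve as competitors in the
  -- two right-hand suprema directly or swapped.
  · have h := (le_abs_self _).trans (h1 t s)
    rcases abs_cases (α t - α s) with ⟨h', -⟩ | ⟨h', -⟩ <;> rw [h'] at h
    · linarith [hp t, hq s]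
    · linarith [hp s, hq t]

/-- Symmetrization and contraction for one coordinate. -/
lemma exp_iSup_symmetrization {T S : Type*} [Finite T] [Nonempty T] [Fintype S] (B : T → ℝ)
    (q : S → ℝ) (hq0 : ∀ s, 0 ≤ q s) (hq1 : ∑ s, q s = 1) (ξ : S → T → ℝ) (h : S → ℝ) (m : T → ℝ)
    (hh : ∀ s, 0 ≤ h s) (hξ0 : ∀ s t, |ξ s t| ≤ h s * |m t|)
    (hξ1 : ∀ s t t', |ξ s t - ξ s t'| ≤ h s * |m t - m t'|) :
    ∑ s, q s * Real.exp (⨆ t, (B t + (ξ s t - ∑ s', q s' * ξ s' t)))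
      ≤ ∑ r : (S × S) × Bool, q r.1.1 * q r.1.2 / 2 *
        Real.exp (⨆ t, (B t + boolSign r.2 * (h r.1.1 + h r.1.2) * m t)) := by
  set D : S → S → ℝ := fun s s' => Real.exp (⨆ t, (B t + (ξ s t - ξ s' t))) with hD
  -- Convexity of `exp` moves the average over an independent copy `s'` outside, replacing the mean
  -- by `ξ s'`.
  have jensen : ∑ s, q s * Real.exp (⨆ t, (B t + (ξ s t - ∑ s', q s' * ξ s' t)))
      ≤ ∑ s, ∑ s', q s * q s' * D s s' := by
    refine Finset.sum_le_sum fun s _ => ?_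
    simp_rw [mul_assoc, ← Finset.mul_sum]
    refine mul_le_mul_of_nonneg_left ?_ (hq0 s)
    obtain ⟨t, ht⟩ := exists_eq_ciSup_of_finite
      (f := fun t => B t + (ξ s t - ∑ s', q s' * ξ s' t))
    rw [← ht]
    have e : B t + (ξ s t - ∑ s', q s' * ξ s' t)
        = ∑ s', q s' • (B t + (ξ s t - ξ s' t)) := by
      simp only [smul_eq_mul, mul_add, mul_sub, Finset.sum_add_distrib, Finset.sum_sub_distrib,
        ← Finset.sum_mul, hq1, one_mul]
    rw [e]
    refine (convexOn_exp.map_sum_le (fun s' _ => hq0 s') hq1 fun _ _ => Set.mem_univ _).trans ?_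
    refine Finset.sum_le_sum fun s' _ => mul_le_mul_of_nonneg_left (Real.exp_le_exp.2 ?_) (hq0 s')
    exact le_ciSup (f := fun t => B t + (ξ s t - ξ s' t)) (Set.finite_range _).bddAbove t
  have symm : ∑ s, ∑ s', q s * q s' * D s s'
      = ∑ s, ∑ s', q s * q s' / 2 * (D s s' + D s' s) := by
    have hswap : ∑ s, ∑ s', q s * q s' * D s s' = ∑ s, ∑ s', q s * q s' * D s' s := by
      rw [Finset.sum_comm]
      exact Finset.sum_congr rfl fun s _ => Finset.sum_congr rfl fun s' _ => by ring
    have : ∑ s, ∑ s', q s * q s' / 2 * (D s s' + D s' s)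
        = (∑ s, ∑ s', q s * q s' * D s s' + ∑ s, ∑ s', q s * q s' * D s' s) / 2 := by
      simp_rw [← Finset.sum_add_distrib, Finset.sum_div]
      exact Finset.sum_congr rfl fun s _ => Finset.sum_congr rfl fun s' _ => by ring
    rw [this, ← hswap]
    ring
  refine jensen.trans (symm.le.trans ?_)
  rw [Fintype.sum_prod_type, Fintype.sum_prod_type]
  refine Finset.sum_le_sum fun s _ => Finset.sum_le_sum fun s' _ => ?_
  rw [Fintype.sum_bool]
  simp only [boolSign_true, boolSign_false]
  rw [← mul_add]
  refine mul_le_mul_of_nonneg_left ?_ (by have := hq0 s; have := hq0 s'; positivity)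
  have habs : ∀ z, |(h s + h s') * z| = h s * |z| + h s' * |z| := fun z => by
    rw [abs_mul, abs_of_nonneg (add_nonneg (hh s) (hh s')), add_mul]
  -- Exchanging the two copies flips the sign of `ξ s - ξ s'`, so contraction applies to the
  -- resulting pair.
  have key := exp_iSup_contraction B (fun t => ξ s t - ξ s' t) (fun t => (h s + h s') * m t)
    (fun t => by
      rw [habs]
      exact (abs_sub _ _).trans (add_le_add (hξ0 s t) (hξ0 s' t)))
    (fun t t' => by
      rw [← mul_sub, habs]
      calc |ξ s t - ξ s' t - (ξ s t' - ξ s' t')|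
          = |(ξ s t - ξ s t') - (ξ s' t - ξ s' t')| := by ring_nf
        _ ≤ _ := (abs_sub _ _).trans (add_le_add (hξ1 s t t') (hξ1 s' t t')))
  refine le_trans (le_of_eq ?_) (key.trans (le_of_eq ?_))
  · simp only [hD, sub_eq_add_neg, neg_add, neg_neg]
    simp only [add_comm]
  · simp only [one_mul, neg_mul, sub_eq_add_neg]

/-- Tensorization of a one-coordinate comparison of exponential suprema. -/
lemma exp_iSup_tensor_fin {T S S' : Type*} [Fintype S] [Fintype S'] : ∀ {k : ℕ}
    (q : Fin k → S → ℝ) (r : Fin k → S' → ℝ) (ξ : Fin k → S → T → ℝ) (ζ : Fin k → S' → T → ℝ)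
    (_ : ∀ i s, 0 ≤ q i s) (_ : ∀ i s, 0 ≤ r i s)
    (_ : ∀ i (B : T → ℝ), ∑ s, q i s * Real.exp (⨆ t, (B t + ξ i s t))
      ≤ ∑ s, r i s * Real.exp (⨆ t, (B t + ζ i s t))) (B : T → ℝ),
    ∑ s : Fin k → S, (∏ i, q i (s i)) * Real.exp (⨆ t, (B t + ∑ i, ξ i (s i) t))
      ≤ ∑ s : Fin k → S', (∏ i, r i (s i)) * Real.exp (⨆ t, (B t + ∑ i, ζ i (s i) t))
  | 0, q, r, ξ, ζ, hq, hr, hstep, B => by simp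
  | k + 1, q, r, ξ, ζ, hq, hr, hstep, B => by
    rw [sum_fin_cons, sum_fin_cons]
    simp only [Fin.prod_univ_succ, Fin.sum_univ_succ, Fin.cons_zero, Fin.cons_succ, ← add_assoc,
      mul_assoc, ← Finset.mul_sum]
    -- The coordinates not being replaced are absorbed into the arbitrary offset `B`.
    have ih := exp_iSup_tensor_fin (fun i => q i.succ) (fun i => r i.succ) (fun i => ξ i.succ)
      (fun i => ζ i.succ) (fun i => hq _) (fun i => hr _) (fun i => hstep _)
    calc _ ≤ ∑ s, q 0 s * ∑ σ : Fin k → S', (∏ i, r i.succ (σ i)) *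
          Real.exp (⨆ t, (B t + ξ 0 s t + ∑ i, ζ i.succ (σ i) t)) :=
        Finset.sum_le_sum fun s _ => mul_le_mul_of_nonneg_left (ih _) (hq _ _)
      _ = ∑ σ : Fin k → S', (∏ i, r i.succ (σ i)) * ∑ s, q 0 s *
          Real.exp (⨆ t, (B t + ∑ i, ζ i.succ (σ i) t + ξ 0 s t)) := by
        simp_rw [Finset.mul_sum]
        rw [Finset.sum_comm]
        refine Finset.sum_congr rfl fun σ _ => Finset.sum_congr rfl fun s _ => ?_
        simp_rw [add_right_comm (B _) (ξ 0 s _)]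
        ring
      _ ≤ ∑ σ : Fin k → S', (∏ i, r i.succ (σ i)) * ∑ s, r 0 s *
          Real.exp (⨆ t, (B t + ∑ i, ζ i.succ (σ i) t + ζ 0 s t)) :=
        Finset.sum_le_sum fun σ _ => mul_le_mul_of_nonneg_left (hstep 0 _)
          (Finset.prod_nonneg fun i _ => hr _ _)
      _ = _ := by
        simp_rw [Finset.mul_sum]
        rw [Finset.sum_comm]
        refine Finset.sum_congr rfl fun σ _ => Finset.sum_congr rfl fun s _ => ?_
        simp_rw [add_right_comm (B _) _ (ζ 0 σ _)]
        ring

lemma sum_prod_exp_iSup_comp_equiv {I I' R T : Type*} [Fintype I] [Fintype I'] [Fintype R]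
    [DecidableEq I] [DecidableEq I'] (e : I ≃ I') (a : I → R → ℝ) (b : I → R → T → ℝ) :
    ∑ s : I' → R, (∏ l, a (e.symm l) (s l)) * Real.exp (⨆ t, ∑ l, b (e.symm l) (s l) t)
      = ∑ s : I → R, (∏ i, a i (s i)) * Real.exp (⨆ t, ∑ i, b i (s i) t) := by
  refine Fintype.sum_equiv (e.arrowCongr (Equiv.refl R)).symm _ _ fun s => ?_
  have h1 : ∏ l, a (e.symm l) (s l) = ∏ i, a i (s (e i)) := by
    rw [← e.symm.prod_comp fun i => a i (s (e i))]
    simp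
  have h2 : ∀ t, ∑ l, b (e.symm l) (s l) t = ∑ i, b i (s (e i)) t := fun t => by
    rw [← e.symm.sum_comp fun i => b i (s (e i)) t]
    simp
  simp only [h1, h2]
  rfl

lemma exp_iSup_tensor {I T S S' : Type*} [Fintype I] [Fintype S] [Fintype S'] [DecidableEq I]
    (q : I → S → ℝ) (r : I → S' → ℝ) (ξ : I → S → T → ℝ) (ζ : I → S' → T → ℝ)
    (hq : ∀ i s, 0 ≤ q i s) (hr : ∀ i s, 0 ≤ r i s)
    (hstep : ∀ i (B : T → ℝ), ∑ s, q i s * Real.exp (⨆ t, (B t + ξ i s t))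
      ≤ ∑ s, r i s * Real.exp (⨆ t, (B t + ζ i s t))) :
    ∑ s : I → S, (∏ i, q i (s i)) * Real.exp (⨆ t, ∑ i, ξ i (s i) t)
      ≤ ∑ s : I → S', (∏ i, r i (s i)) * Real.exp (⨆ t, ∑ i, ζ i (s i) t) := by
  let e := Fintype.equivFin I
  have h := exp_iSup_tensor_fin (fun l => q (e.symm l)) (fun l => r (e.symm l))
    (fun l => ξ (e.symm l)) (fun l => ζ (e.symm l)) (fun l => hq _) (fun l => hr _)
    (fun l => hstep _) (fun _ => 0)
  simp only [zero_add] at h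
  rwa [sum_prod_exp_iSup_comp_equiv, sum_prod_exp_iSup_comp_equiv] at h

/-- The exponential moment of the supremum of a centred process over an `ι × κ` array is at most
that of the maximal bilinear form in signs, whose coefficients are symmetrized. -/
lemma exp_iSup_centred_le {ι κ T S : Type*} [Fintype ι] [Fintype κ] [DecidableEq ι]
    [DecidableEq κ] [Finite T] [Nonempty T] [Fintype S]
    (q : ι × κ → S → ℝ) (hq0 : ∀ p s, 0 ≤ q p s) (hq1 : ∀ p, ∑ s, q p s = 1)
    (ξ : ι × κ → S → T → ℝ) (h : S → ℝ) (m : ι × κ → T → ℝ) (hh : ∀ s, 0 ≤ h s)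
    (hξ0 : ∀ p s t, |ξ p s t| ≤ h s * |m p t|)
    (hξ1 : ∀ p s t t', |ξ p s t - ξ p s t'| ≤ h s * |m p t - m p t'|) {γ V : ℝ}
    (hm : ∀ (E : ι → κ → ℝ) (D : ℝ),
      (∀ (x : ι → Bool) (y : κ → Bool), ∑ i, ∑ j, E i j * (boolSign (x i) * boolSign (y j)) ≤ D) →
      ∀ t, ∑ i, ∑ j, E i j * m (i, j) t ≤ γ * D)
    (hV : ∀ p, ∑ s, ∑ s', q p s * q p s' * Real.cosh (γ * (h s + h s')) ≤ V) :
    ∑ s : ι × κ → S, (∏ p, q p (s p)) *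
        Real.exp (⨆ t, ∑ p, (ξ p (s p) t - ∑ s', q p s' * ξ p s' t))
      ≤ 2 ^ (Fintype.card ι + Fintype.card κ) * V ^ (Fintype.card ι * Fintype.card κ) := by
  set r : ι × κ → (S × S) × Bool → ℝ := fun p s => q p s.1.1 * q p s.1.2 / 2 with hr
  have hr0 : ∀ p s, 0 ≤ r p s := fun p s => by
    have := hq0 p s.1.1; have := hq0 p s.1.2; positivity
  set η : (S × S) × Bool → ℝ := fun s => boolSign s.2 * (h s.1.1 + h s.1.2) with hη
  refine (exp_iSup_tensor q r _ (fun p s t => η s * m p t) hq0 hr0 fun p B =>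
    exp_iSup_symmetrization B (q p) (hq0 p) (hq1 p) (ξ p) h (m p) hh (hξ0 p) (hξ1 p)).trans ?_
  -- `hm` passes from the supremum over `t` to the best pair of sign vectors, and that maximum is at
  -- most the sum over all pairs.
  have bound : ∀ s : ι × κ → (S × S) × Bool,
      Real.exp (⨆ t, ∑ p, η (s p) * m p t)
        ≤ ∑ z : (ι → Bool) × (κ → Bool),
          ∏ p : ι × κ, Real.exp (γ * (η (s p) * (boolSign (z.1 p.1) * boolSign (z.2 p.2)))) := by
    intro s
    obtain ⟨t, ht⟩ := exists_eq_ciSup_of_finite (f := fun t => ∑ p, η (s p) * m p t)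
    obtain ⟨z, hz⟩ := Finite.exists_max fun z : (ι → Bool) × (κ → Bool) =>
      ∑ i, ∑ j, η (s (i, j)) * (boolSign (z.1 i) * boolSign (z.2 j))
    have h1 := hm (fun i j => η (s (i, j))) _ (fun x y => hz (x, y)) t
    rw [← ht]
    refine le_trans ?_ (Finset.single_le_sum
      (fun z _ => Finset.prod_nonneg fun p _ => (Real.exp_pos _).le) (Finset.mem_univ z))
    rw [← Real.exp_sum, Real.exp_le_exp, ← Finset.mul_sum, Fintype.sum_prod_type,
      Fintype.sum_prod_type]
    exact h1
  -- The fixed sign from `z` is absorbed by the symmetric sign in `s`, leaving a hyperbolic cosine.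
  have coord : ∀ (p : ι × κ) (z : (ι → Bool) × (κ → Bool)),
      ∑ s, r p s * Real.exp (γ * (η s * (boolSign (z.1 p.1) * boolSign (z.2 p.2)))) ≤ V := by
    intro p z
    refine le_trans (le_of_eq ?_) (hV p)
    rw [Fintype.sum_prod_type, Fintype.sum_prod_type]
    refine Finset.sum_congr rfl fun s _ => Finset.sum_congr rfl fun s' _ => ?_
    rw [Fintype.sum_bool, Real.cosh_eq]
    rcases z.1 p.1 <;> rcases z.2 p.2 <;>
      · simp only [hr, hη, boolSign_true, boolSign_false]
        ring_nf
  calc _ ≤ ∑ s : ι × κ → (S × S) × Bool, (∏ p, r p (s p)) *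
        ∑ z : (ι → Bool) × (κ → Bool),
          ∏ p : ι × κ, Real.exp (γ * (η (s p) * (boolSign (z.1 p.1) * boolSign (z.2 p.2)))) :=
      Finset.sum_le_sum fun s _ => mul_le_mul_of_nonneg_left (bound s)
        (Finset.prod_nonneg fun p _ => hr0 _ _)
    _ = ∑ z : (ι → Bool) × (κ → Bool), ∏ p : ι × κ, ∑ s, r p s *
          Real.exp (γ * (η s * (boolSign (z.1 p.1) * boolSign (z.2 p.2)))) := by
      simp_rw [Finset.mul_sum]
      rw [Finset.sum_comm]
      refine Finset.sum_congr rfl fun z _ => ?_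
      rw [Fintype.prod_sum]
      exact Finset.sum_congr rfl fun s _ => by rw [Finset.prod_mul_distrib]
    _ ≤ ∑ z : (ι → Bool) × (κ → Bool), ∏ p : ι × κ, V :=
      Finset.sum_le_sum fun z _ => Finset.prod_le_prod (fun p _ => Finset.sum_nonneg fun s _ =>
        mul_nonneg (hr0 _ _) (Real.exp_pos _).le) fun p _ => coord p z
    _ = _ := by simp [pow_add]

/-! ### Kullback-Leibler curvature and regularity of the link -/

/-- `log x ≤ x - 1` at `x = √(b/a)`; this compares Kullback-Leibler divergence with squared
Hellinger distance. -/
lemma log_sub_log_le_sqrt {a b : ℝ} (ha : 0 < a) (hb : 0 < b) :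
    a * (Real.log b - Real.log a) ≤ 2 * (√a * √b - a) := by
  have h := Real.log_le_sub_one_of_pos (x := √b / √a) (by positivity)
  rw [Real.log_div (by positivity) (by positivity), Real.log_sqrt hb.le, Real.log_sqrt ha.le] at h
  have h1 := mul_le_mul_of_nonneg_left h ha.le
  have h2 : a * (√b / √a) = √a * √b := by
    rw [mul_div_left_comm, Real.div_sqrt, mul_comm]
  nlinarith

/-- A quadratic lower bound on the Kullback-Leibler divergence of Bernoulli laws. -/
lemma bernoulli_kl_lower_bound {a b : ℝ} (ha : a ∈ Set.Ioo (0 : ℝ) 1)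
    (hb : b ∈ Set.Ioo (0 : ℝ) 1) :
    a * (Real.log b - Real.log a) + (1 - a) * (Real.log (1 - b) - Real.log (1 - a))
      ≤ - ((a - b) ^ 2 / 2) := by
  -- `(x - y)² = (√x - √y)² (√x + √y)²`, with last factor at most `4`.
  have key : ∀ x y : ℝ, x ∈ Set.Ioo (0 : ℝ) 1 → y ∈ Set.Ioo (0 : ℝ) 1 →
      (x - y) ^ 2 / 4 ≤ x + y - 2 * (√x * √y) := by
    intro x y hx hy
    have hx1 := Real.sq_sqrt hx.1.le
    have hy1 := Real.sq_sqrt hy.1.le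
    have hx2 : √x ≤ 1 := Real.sqrt_le_one.2 hx.2.le
    have hy2 : √y ≤ 1 := Real.sqrt_le_one.2 hy.2.le
    have hx0 := Real.sqrt_nonneg x
    have hy0 := Real.sqrt_nonneg y
    have e1 : (x - y) ^ 2 = (√x - √y) ^ 2 * (√x + √y) ^ 2 := by
      rw [← mul_pow]
      congr 1
      nlinarith
    have e2 : x + y - 2 * (√x * √y) = (√x - √y) ^ 2 := by nlinarith
    have e3 : (√x + √y) ^ 2 ≤ 4 := by nlinarith
    rw [e1, e2]
    nlinarith [mul_le_mul_of_nonneg_left e3 (sq_nonneg (√x - √y))]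
  have ha' : 1 - a ∈ Set.Ioo (0 : ℝ) 1 := ⟨by linarith [ha.2], by linarith [ha.1]⟩
  have hb' : 1 - b ∈ Set.Ioo (0 : ℝ) 1 := ⟨by linarith [hb.2], by linarith [hb.1]⟩
  have h1 := log_sub_log_le_sqrt ha.1 hb.1
  have h2 := log_sub_log_le_sqrt ha'.1 hb'.1
  have h3 := key a b ha hb
  have h4 := key _ _ ha' hb'
  have h5 : (1 - a - (1 - b)) ^ 2 = (a - b) ^ 2 := by ring
  rw [h5] at h4
  linarith

namespace IFA

variable {C : ℝ} {f : ℝ → ℝ}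

/-- The derivatives of `log f` and `log (1 - f)` are dominated by `|f'| / (f (1 - f))`, since both
`f` and `1 - f` are below `1`. -/
lemma LinkRegular.exists_lipschitz (hf : LinkRegular C f) :
    ∃ L : ℝ, 0 < L ∧ ∀ x y : ℝ, |x| ≤ C ^ 2 → |y| ≤ C ^ 2 →
      |Real.log (f x) - Real.log (f y)| ≤ L * |x - y| ∧
      |Real.log (1 - f x) - Real.log (1 - f y)| ≤ L * |x - y| := by
  obtain ⟨L, hL⟩ := hf.bddAbove_left
  have hL' : ∀ x, |x| ≤ C ^ 2 → |deriv f x| / (f x * (1 - f x)) ≤ max L 1 := fun x hx =>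
    (hL ⟨x, hx, rfl⟩).trans (le_max_left _ _)
  refine ⟨max L 1, by positivity, fun x y hx hy => ?_⟩
  have hconv : Convex ℝ (Set.Icc (-C ^ 2) (C ^ 2)) := convex_Icc _ _
  have hmem : ∀ z, z ∈ Set.Icc (-C ^ 2) (C ^ 2) ↔ |z| ≤ C ^ 2 := fun z => by
    rw [Set.mem_Icc, abs_le]
  constructor
  · refine hconv.norm_image_sub_le_of_norm_hasDerivWithin_le
      (f := fun z => Real.log (f z)) (f' := fun z => deriv f z / f z) (fun z hz => ?_)
      (fun z hz => ?_) ((hmem y).2 hy) ((hmem x).2 hx)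
    · exact ((hf.differentiable z).hasDerivAt.log
        (hf.mem_Ioo z ((hmem z).1 hz)).1.ne').hasDerivWithinAt
    · obtain ⟨h0, h1⟩ := hf.mem_Ioo z ((hmem z).1 hz)
      refine le_trans ?_ (hL' z ((hmem z).1 hz))
      rw [Real.norm_eq_abs, abs_div, abs_of_pos h0]
      exact div_le_div_of_nonneg_left (abs_nonneg _) (mul_pos h0 (by linarith))
        (mul_le_of_le_one_right h0.le (by linarith))
  · refine hconv.norm_image_sub_le_of_norm_hasDerivWithin_le
      (f := fun z => Real.log (1 - f z)) (f' := fun z => -deriv f z / (1 - f z)) (fun z hz => ?_)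
      (fun z hz => ?_) ((hmem y).2 hy) ((hmem x).2 hx)
    · have h1 := (hf.mem_Ioo z ((hmem z).1 hz)).2
      exact (((hf.differentiable z).hasDerivAt.const_sub 1).log
        (by linarith : (0 : ℝ) < 1 - f z).ne').hasDerivWithinAt
    · obtain ⟨h0, h1⟩ := hf.mem_Ioo z ((hmem z).1 hz)
      have h2 : 0 < 1 - f z := by linarith
      refine le_trans ?_ (hL' z ((hmem z).1 hz))
      rw [Real.norm_eq_abs, abs_div, abs_of_pos h2, abs_neg]
      exact div_le_div_of_nonneg_left (abs_nonneg _) (mul_pos h0 h2)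
        (mul_le_of_le_one_left h2.le h1.le)

/-- `f (1 - f)` has a positive minimum on the compact interval, and the second supremum transfers it
to `f'²`. Continuity of `f'` is not needed. -/
lemma LinkRegular.exists_deriv_sq_lower_bound (hf : LinkRegular C f) :
    ∃ c : ℝ, 0 < c ∧ ∀ x, |x| ≤ C ^ 2 → c ≤ deriv f x ^ 2 := by
  obtain ⟨β, hβ⟩ := hf.bddAbove_right
  have hcomp : IsCompact (Set.Icc (-C ^ 2) (C ^ 2)) := isCompact_Icc
  have hmem : ∀ z, z ∈ Set.Icc (-C ^ 2) (C ^ 2) ↔ |z| ≤ C ^ 2 := fun z => by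
    rw [Set.mem_Icc, abs_le]
  have hcont := hf.differentiable.continuous
  obtain ⟨z, hz, hmin⟩ := hcomp.exists_isMinOn (f := fun x => f x * (1 - f x))
    ⟨0, by rw [hmem, abs_zero]; positivity⟩ (by fun_prop)
  obtain ⟨h0, h1⟩ := hf.mem_Ioo z ((hmem z).1 hz)
  have hpos : 0 < f z * (1 - f z) := mul_pos h0 (by linarith)
  refine ⟨f z * (1 - f z) / max β 1, by positivity, fun x hx => ?_⟩
  have h2 : f z * (1 - f z) ≤ f x * (1 - f x) := hmin ((hmem x).2 hx)
  have h3 : f x * (1 - f x) / deriv f x ^ 2 ≤ max β 1 := (hβ ⟨x, hx, rfl⟩).trans (le_max_left _ _)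
  have h4 : 0 < deriv f x ^ 2 := by
    have := hf.deriv_ne_zero x hx
    positivity
  rw [div_le_iff₀ h4] at h3
  rw [div_le_iff₀ (by positivity)]
  linarith

lemma LinkRegular.exists_kl_lower_bound (hf : LinkRegular C f) :
    ∃ c : ℝ, 0 < c ∧ ∀ x y : ℝ, |x| ≤ C ^ 2 → |y| ≤ C ^ 2 →
      f y * (Real.log (f x) - Real.log (f y))
        + (1 - f y) * (Real.log (1 - f x) - Real.log (1 - f y)) ≤ - (c * (x - y) ^ 2) := by
  obtain ⟨c, hc, hd⟩ := hf.exists_deriv_sq_lower_bound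
  refine ⟨c / 2, by positivity, fun x y hx hy => ?_⟩
  refine (bernoulli_kl_lower_bound (hf.mem_Ioo y hy) (hf.mem_Ioo x hx)).trans ?_
  have key : ∀ x y : ℝ, x < y → |x| ≤ C ^ 2 → |y| ≤ C ^ 2 → c * (x - y) ^ 2 ≤ (f x - f y) ^ 2 := by
    intro x y hxy hx hy
    obtain ⟨z, hz, hzd⟩ := exists_deriv_eq_slope f hxy hf.differentiable.continuous.continuousOn
      hf.differentiable.differentiableOn
    rw [abs_le] at hx hy
    have h := hd z (abs_le.2 ⟨by linarith [hz.1], by linarith [hz.2]⟩)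
    rw [eq_div_iff (by linarith)] at hzd
    have e : (f x - f y) ^ 2 = deriv f z ^ 2 * (x - y) ^ 2 := by
      rw [← neg_sub (f y), ← hzd]; ring
    rw [e]
    exact mul_le_mul_of_nonneg_right h (sq_nonneg _)
  have h : c * (x - y) ^ 2 ≤ (f y - f x) ^ 2 := by
    rcases lt_trichotomy x y with h | h | h
    · have := key x y h hx hy
      nlinarith
    · simp [h]
    · have := key y x h hy hx
      nlinarith
  linarith

end IFA

/-! ### Feasible parameters, the log-likelihood and existence of an estimate -/

namespace IFA

variable {C : ℝ} {f : ℝ → ℝ} {N J K : ℕ}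

lemma norm_toLp_sq (v : Fin K → ℝ) : ‖WithLp.toLp 2 v‖ ^ 2 = ∑ l, v l ^ 2 := by
  rw [EuclideanSpace.norm_sq_eq]
  simp

lemma feasible_iff (hC : 0 ≤ C) (Θ : Matrix (Fin N) (Fin K) ℝ) (A : Matrix (Fin J) (Fin K) ℝ)
    (d : Fin J → ℝ) : Feasible C Θ A d ↔
      (∀ i, 1 + ∑ l, Θ i l ^ 2 ≤ C ^ 2) ∧ ∀ j, d j ^ 2 + ∑ l, A j l ^ 2 ≤ C ^ 2 := by
  simp only [Feasible, Real.sqrt_le_left hC, norm_toLp_sq]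

lemma scoreMatrix_apply (Θ : Matrix (Fin N) (Fin K) ℝ) (A : Matrix (Fin J) (Fin K) ℝ)
    (d : Fin J → ℝ) (i : Fin N) (j : Fin J) : scoreMatrix Θ A d i j = d j + A j ⬝ᵥ Θ i := by
  simp [scoreMatrix, Matrix.mul_apply, dotProduct, add_comm, mul_comm]

/-- Cauchy-Schwarz for `(d_j, a_j)` and `(1, θ_i)` in dimension `K + 1`. -/
lemma abs_score_le (hC : 0 ≤ C) {Θ : Matrix (Fin N) (Fin K) ℝ} {A : Matrix (Fin J) (Fin K) ℝ}
    {d : Fin J → ℝ} (h : Feasible C Θ A d) (i : Fin N) (j : Fin J) :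
    |d j + A j ⬝ᵥ Θ i| ≤ C ^ 2 := by
  rw [feasible_iff hC] at h
  have hcs := Finset.sum_mul_sq_le_sq_mul_sq Finset.univ
    (Fin.cons (d j) (A j) : Fin (K + 1) → ℝ) (Fin.cons 1 (Θ i))
  simp only [Fin.sum_univ_succ, Fin.cons_zero, Fin.cons_succ, mul_one, one_pow] at hcs
  refine abs_le_of_sq_le_sq (hcs.trans ?_) (by positivity)
  rw [sq (C ^ 2)]
  have h1 := h.1 i
  have h2 := h.2 j
  have h0 : 0 ≤ ∑ l, Θ i l ^ 2 := Finset.sum_nonneg fun l _ => sq_nonneg _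
  exact mul_le_mul h2 h1 (by positivity) (by positivity)

/-- The contribution of one entry to the log-likelihood of the observed data. -/
def logTerm (f : ℝ → ℝ) (s : Bool × Bool) (x : ℝ) : ℝ :=
  if s.2 = true then (if s.1 = true then Real.log (f x) else Real.log (1 - f x)) else 0

lemma log_likelihood (hC : 0 ≤ C) (hf : LinkRegular C f) (y w : Fin N → Fin J → Bool)
    {Θ : Matrix (Fin N) (Fin K) ℝ} {A : Matrix (Fin J) (Fin K) ℝ} {d : Fin J → ℝ}
    (h : Feasible C Θ A d) : Real.log (likelihood f y w Θ A d)
      = ∑ p : Fin N × Fin J, logTerm f (y p.1 p.2, w p.1 p.2) (d p.2 + A p.2 ⬝ᵥ Θ p.1) := by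
  rw [likelihood, Real.log_prod, Finset.sum_filter]
  · refine Finset.sum_congr rfl fun p _ => ?_
    simp only [logTerm, apply_ite Real.log]
  · intro p _
    obtain ⟨h0, h1⟩ := hf.mem_Ioo _ (abs_score_le hC h p.1 p.2)
    split_ifs
    · exact h0.ne'
    · exact (sub_pos.2 h1).ne'

lemma isCompact_feasible (hC : 0 ≤ C) :
    IsCompact {x : (Fin N → Fin K → ℝ) × (Fin J → Fin K → ℝ) × (Fin J → ℝ) |
      Feasible C (Matrix.of x.1) (Matrix.of x.2.1) x.2.2} := by
  have hsub : {x : (Fin N → Fin K → ℝ) × (Fin J → Fin K → ℝ) × (Fin J → ℝ) |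
      Feasible C (Matrix.of x.1) (Matrix.of x.2.1) x.2.2} ⊆ Metric.closedBall 0 C := by
    rintro ⟨Θ, A, d⟩ h
    rw [Set.mem_ofPred_eq, feasible_iff hC] at h
    have hb : ∀ {k : ℕ} (v : Fin k → ℝ), ∑ l, v l ^ 2 ≤ C ^ 2 → ‖v‖ ≤ C := by
      intro k v hv
      refine (pi_norm_le_iff_of_nonneg hC).2 fun l => abs_le_of_sq_le_sq ?_ hC
      exact (Finset.single_le_sum (f := fun l => v l ^ 2) (fun l _ => sq_nonneg _)
        (Finset.mem_univ l)).trans hv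
    rw [mem_closedBall_zero_iff, norm_prod_le_iff, norm_prod_le_iff]
    refine ⟨(pi_norm_le_iff_of_nonneg hC).2 fun i => hb _ ?_,
      (pi_norm_le_iff_of_nonneg hC).2 fun j => hb _ ?_,
      (pi_norm_le_iff_of_nonneg hC).2 fun j => abs_le_of_sq_le_sq ?_ hC⟩
    · have := h.1 i
      simp only [Matrix.of_apply] at this
      linarith
    · have := h.2 j
      simp only [Matrix.of_apply] at this
      nlinarith [sq_nonneg (d j)]
    · have := h.2 j
      have h0 : 0 ≤ ∑ l, A j l ^ 2 := Finset.sum_nonneg fun l _ => sq_nonneg _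
      simp only [Matrix.of_apply] at this
      linarith
  refine (isCompact_closedBall _ _).of_isClosed_subset ?_ hsub
  simp only [feasible_iff hC, Matrix.of_apply, Set.ofPred_and, Set.ofPred_forall]
  refine IsClosed.inter (isClosed_iInter fun i => isClosed_le (by fun_prop) (by fun_prop))
    (isClosed_iInter fun j => isClosed_le (by fun_prop) (by fun_prop))

lemma exists_isCJMLE (hC : 0 ≤ C) (hf : LinkRegular C f) (y w : Fin N → Fin J → Bool)
    {Θs : Matrix (Fin N) (Fin K) ℝ} {As : Matrix (Fin J) (Fin K) ℝ} {ds : Fin J → ℝ}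
    (hs : Feasible C Θs As ds) :
    ∃ (Θ : Matrix (Fin N) (Fin K) ℝ) (A : Matrix (Fin J) (Fin K) ℝ) (d : Fin J → ℝ),
      IsCJMLE C f y w Θ A d := by
  have hcont := hf.differentiable.continuous
  have hpos : ∀ (Θ : Matrix (Fin N) (Fin K) ℝ) (A : Matrix (Fin J) (Fin K) ℝ) (d : Fin J → ℝ),
      Feasible C Θ A d → 0 < likelihood f y w Θ A d := by
    intro Θ A d h
    refine Finset.prod_pos fun p _ => ?_
    obtain ⟨h0, h1⟩ := hf.mem_Ioo _ (abs_score_le hC h p.1 p.2)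
    split_ifs
    · exact h0
    · exact sub_pos.2 h1
  obtain ⟨⟨Θ, A, d⟩, h, hmax⟩ := (isCompact_feasible (N := N) (J := J) (K := K) hC).exists_isMaxOn
    (f := fun x => likelihood f y w (Matrix.of x.1) (Matrix.of x.2.1) x.2.2)
    ⟨(Θs, As, ds), hs⟩ (by
      refine Continuous.continuousOn ?_
      unfold likelihood
      refine continuous_finsetProd _ fun p _ => ?_
      have : Continuous fun x : (Fin N → Fin K → ℝ) × (Fin J → Fin K → ℝ) × (Fin J → ℝ) =>
          x.2.2 p.2 + Matrix.of x.2.1 p.2 ⬝ᵥ Matrix.of x.1 p.1 := by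
        simp only [dotProduct, Matrix.of_apply]
        fun_prop
      split_ifs
      · exact hcont.comp this
      · exact continuous_const.sub (hcont.comp this))
  refine ⟨Matrix.of Θ, Matrix.of A, d, h, fun Θ' A' d' h' => ?_⟩
  exact Real.log_le_log (hpos _ _ _ h') (hmax (a := (Θ', A', d')) h')

/-- A score matrix with feasible parameters pairs with a matrix `E` at most `8 C²` times as much
as sign matrices of rank one do. -/
lemma sum_mul_score_le (hC : 0 < C) {Θ : Matrix (Fin N) (Fin K) ℝ} {A : Matrix (Fin J) (Fin K) ℝ}
    {d : Fin J → ℝ} (h : Feasible C Θ A d) {E : Fin N → Fin J → ℝ} {D : ℝ}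
    (hD : ∀ (x : Fin N → Bool) (y : Fin J → Bool),
      ∑ i, ∑ j, E i j * (boolSign (x i) * boolSign (y j)) ≤ D) :
    ∑ i, ∑ j, E i j * (d j + A j ⬝ᵥ Θ i) ≤ 8 * C ^ 2 * D ∧
      -∑ i, ∑ j, E i j * (d j + A j ⬝ᵥ Θ i) ≤ 8 * C ^ 2 * D := by
  rw [feasible_iff hC.le] at h
  -- Dividing the augmented vectors by `C` puts them in the unit ball; `ε = ±1` on one side gives
  -- both signs.
  have key : ∀ ε : ℝ, ε ^ 2 = 1 →
      ε * ∑ i, ∑ j, E i j * (d j + A j ⬝ᵥ Θ i) ≤ 8 * C ^ 2 * D := by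
    intro ε hε
    have hg := grothendieck_inequality hD (K + 1)
      (fun i => Fin.cons (ε / C) (fun l => ε * Θ i l / C))
      (fun j => Fin.cons (d j / C) (fun l => A j l / C))
      (fun i => by
        have := h.1 i
        simp only [Fin.sum_univ_succ, Fin.cons_zero, Fin.cons_succ, div_pow, mul_pow, hε, one_mul]
        rw [← Finset.sum_div, ← add_div, div_le_one (by positivity)]
        exact this)
      (fun j => by
        have := h.2 j
        simp only [Fin.sum_univ_succ, Fin.cons_zero, Fin.cons_succ, div_pow]
        rw [← Finset.sum_div, ← add_div, div_le_one (by positivity)]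
        exact this)
    have e : ∀ i j, ∑ l, (Fin.cons (ε / C) (fun l => ε * Θ i l / C) : Fin (K + 1) → ℝ) l
          * (Fin.cons (d j / C) (fun l => A j l / C) : Fin (K + 1) → ℝ) l
        = ε * (d j + A j ⬝ᵥ Θ i) / C ^ 2 := by
      intro i j
      simp only [Fin.sum_univ_succ, Fin.cons_zero, Fin.cons_succ, dotProduct, mul_add, add_div,
        Finset.mul_sum, Finset.sum_div]
      congr 1
      · ring
      · exact Finset.sum_congr rfl fun l _ => by ring
    simp_rw [e, mul_div_assoc', mul_left_comm _ ε, ← Finset.sum_div, ← Finset.mul_sum] at hg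
    rw [div_le_iff₀ (by positivity)] at hg
    linarith
  exact ⟨by simpa using key 1 (by norm_num), by simpa using key (-1) (by norm_num)⟩

end IFA

/-! ### The finite law of the data and the uniform deviation bound -/

/-- The probability mass function of the Bernoulli law on `Bool` with success probability `a`. -/
def bernoulliWeight (a : ℝ) (b : Bool) : ℝ := if b = true then a else 1 - a

lemma bernoulliWeight_nonneg {a : ℝ} (h0 : 0 ≤ a) (h1 : a ≤ 1) (b : Bool) :
    0 ≤ bernoulliWeight a b := by
  unfold bernoulliWeight
  split_ifs <;> linarith

lemma cosh_le_one_add_sq {x : ℝ} (hx : x ^ 2 ≤ 1) : Real.cosh x ≤ 1 + x ^ 2 := by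
  have h := Real.exp_bound_div_one_sub_of_interval (x := x ^ 2 / 2) (by positivity) (by linarith)
  refine (Real.cosh_le_exp_half_sq x).trans (h.trans ?_)
  rw [div_le_iff₀ (by linarith)]
  nlinarith [sq_nonneg x]

lemma measureReal_bool_preimage {Ω : Type*} [MeasurableSpace Ω] {P : Measure Ω}
    [IsProbabilityMeasure P] {X : Ω → Bool} (hX : Measurable X) {a : ℝ}
    (ha : P.real {ω | X ω = true} = a) (b : Bool) :
    P.real (X ⁻¹' {b}) = bernoulliWeight a b := by
  cases b
  · have h : X ⁻¹' {false} = {ω | X ω = true}ᶜ := by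
      ext ω; simp
    have hm : MeasurableSet {ω | X ω = true} := hX (measurableSet_singleton true)
    rw [h, probReal_compl_eq_one_sub hm, ha]
    simp [bernoulliWeight]
  · exact ha

namespace IFA

variable {C : ℝ} {f : ℝ → ℝ} {N J K : ℕ}

/-- The probability of the outcome `s` of one pair (response, observation indicator). -/
def entryWeight (a ρ : ℝ) (s : Bool × Bool) : ℝ := bernoulliWeight a s.1 * bernoulliWeight ρ s.2

lemma entryWeight_nonneg {a ρ : ℝ} (ha0 : 0 ≤ a) (ha1 : a ≤ 1) (hρ0 : 0 ≤ ρ) (hρ1 : ρ ≤ 1)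
    (s : Bool × Bool) : 0 ≤ entryWeight a ρ s :=
  mul_nonneg (bernoulliWeight_nonneg ha0 ha1 _) (bernoulliWeight_nonneg hρ0 hρ1 _)

lemma sum_entryWeight (a ρ : ℝ) : ∑ s, entryWeight a ρ s = 1 := by
  simp [Fintype.sum_prod_type, entryWeight, bernoulliWeight]
  ring

lemma sum_entryWeight_mul_ite (a ρ : ℝ) :
    ∑ s, entryWeight a ρ s * (if s.2 = true then 1 else 0) = ρ := by
  simp [Fintype.sum_prod_type, entryWeight, bernoulliWeight]
  ring

lemma sum_entryWeight_mul_logTerm (a ρ x y : ℝ) :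
    ∑ s, entryWeight a ρ s * (logTerm f s x - logTerm f s y)
      = ρ * (a * (Real.log (f x) - Real.log (f y))
        + (1 - a) * (Real.log (1 - f x) - Real.log (1 - f y))) := by
  simp [Fintype.sum_prod_type, entryWeight, bernoulliWeight, logTerm]
  ring

lemma IsModel.measureReal_eq_prod {n : ℝ} {Θ : Matrix (Fin N) (Fin K) ℝ}
    {A : Matrix (Fin J) (Fin K) ℝ} {d : Fin J → ℝ} {Ω : Type*} [MeasurableSpace Ω]
    {P : Measure Ω} [IsProbabilityMeasure P] {Y W : Fin N → Fin J → Ω → Bool}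
    (h : IsModel f n Θ A d P Y W) (s : Fin N × Fin J → Bool × Bool) :
    P.real {ω | (fun p : Fin N × Fin J => (Y p.1 p.2 ω, W p.1 p.2 ω)) = s}
      = ∏ p, entryWeight (f (d p.2 + A p.2 ⬝ᵥ Θ p.1)) (n / (N * J)) (s p) := by
  have hset : {ω | (fun p : Fin N × Fin J => (Y p.1 p.2 ω, W p.1 p.2 ω)) = s}
      = ⋂ i ∈ (Finset.univ : Finset ((Fin N × Fin J) ⊕ (Fin N × Fin J))),
        (Sum.elim (fun p : Fin N × Fin J => Y p.1 p.2) (fun p : Fin N × Fin J => W p.1 p.2) i) ⁻¹'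
          {Sum.elim (fun p => (s p).1) (fun p => (s p).2) i} := by
    ext ω
    simp only [Set.mem_ofPred_eq, Finset.mem_univ, Set.iInter_true, Set.mem_iInter,
      Set.mem_preimage, Set.mem_singleton_iff, Sum.forall, Sum.elim_inl, Sum.elim_inr]
    constructor
    · rintro rfl
      exact ⟨fun p => rfl, fun p => rfl⟩
    · rintro ⟨h1, h2⟩
      funext p
      exact Prod.ext (h1 p) (h2 p)
  rw [hset, measureReal_def, h.indep.measure_inter_preimage_eq_mul Finset.univ
    (fun i _ => measurableSet_singleton _), ENNReal.toReal_prod, Fintype.prod_sum_type,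
    ← Finset.prod_mul_distrib]
  refine Finset.prod_congr rfl fun p _ => ?_
  simp only [Sum.elim_inl, Sum.elim_inr, ← measureReal_def]
  rw [measureReal_bool_preimage (h.measurable_Y p.1 p.2) (h.prob_Y p.1 p.2),
    measureReal_bool_preimage (h.measurable_W p.1 p.2) (h.prob_W p.1 p.2)]
  rfl

lemma IsModel.measureReal_le_sum {n : ℝ} {Θ : Matrix (Fin N) (Fin K) ℝ}
    {A : Matrix (Fin J) (Fin K) ℝ} {d : Fin J → ℝ} {Ω : Type*} [MeasurableSpace Ω]
    {P : Measure Ω} [IsProbabilityMeasure P] {Y W : Fin N → Fin J → Ω → Bool}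
    (h : IsModel f n Θ A d P Y W) (B : Finset (Fin N × Fin J → Bool × Bool)) :
    P.real {ω | (fun p : Fin N × Fin J => (Y p.1 p.2 ω, W p.1 p.2 ω)) ∈ B}
      ≤ ∑ s ∈ B, ∏ p, entryWeight (f (d p.2 + A p.2 ⬝ᵥ Θ p.1)) (n / (N * J)) (s p) := by
  have hset : {ω | (fun p : Fin N × Fin J => (Y p.1 p.2 ω, W p.1 p.2 ω)) ∈ B}
      = ⋃ s ∈ B, {ω | (fun p : Fin N × Fin J => (Y p.1 p.2 ω, W p.1 p.2 ω)) = s} := by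
    ext ω
    simp
  rw [hset]
  refine (measureReal_biUnion_finset_le _ _).trans (Finset.sum_le_sum fun s _ => ?_)
  rw [h.measureReal_eq_prod]

/-- The cosine exceeds `1` only if one of the two copies is observed, which brings in the factor
`ρ`. If both are, `(2θ)²` is exactly `2θ²` counted twice, so the bound is linear in the indicators.
-/
lemma sum_entryWeight_cosh_le {a ρ θ : ℝ} (ha0 : 0 ≤ a) (ha1 : a ≤ 1) (hρ0 : 0 ≤ ρ) (hρ1 : ρ ≤ 1)
    (hθ : (2 * θ) ^ 2 ≤ 1) :
    ∑ s, ∑ s', entryWeight a ρ s * entryWeight a ρ s' *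
      Real.cosh (θ * ((if s.2 = true then 1 else 0) + (if s'.2 = true then 1 else 0)))
      ≤ Real.exp (4 * θ ^ 2 * ρ) := by
  have hc : ∀ s s' : Bool × Bool,
      Real.cosh (θ * ((if s.2 = true then 1 else 0) + (if s'.2 = true then 1 else 0)))
        ≤ 1 + 2 * θ ^ 2 * ((if s.2 = true then 1 else 0) + (if s'.2 = true then 1 else 0)) := by
    intro s s'
    have h1 := cosh_le_one_add_sq (x := θ) (by nlinarith [sq_nonneg θ])
    have h2 := cosh_le_one_add_sq hθ
    have h3 := sq_nonneg θ
    split_ifs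
    · rw [show θ * (1 + 1) = 2 * θ by ring]; linarith
    · rw [add_zero, mul_one]; linarith
    · rw [zero_add, mul_one]; linarith
    · simp
  have hq := entryWeight_nonneg ha0 ha1 hρ0 hρ1
  calc _ ≤ ∑ s, ∑ s', entryWeight a ρ s * entryWeight a ρ s' *
        (1 + 2 * θ ^ 2 * ((if s.2 = true then 1 else 0) + (if s'.2 = true then 1 else 0))) :=
      Finset.sum_le_sum fun s _ => Finset.sum_le_sum fun s' _ =>
        mul_le_mul_of_nonneg_left (hc s s') (mul_nonneg (hq s) (hq s'))
    _ = 1 + 4 * θ ^ 2 * ρ := by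
      have e : ∀ s : Bool × Bool, ∑ s', entryWeight a ρ s * entryWeight a ρ s' *
          (1 + 2 * θ ^ 2 * ((if s.2 = true then 1 else 0) + (if s'.2 = true then 1 else 0)))
          = entryWeight a ρ s * ((1 + 2 * θ ^ 2 * ρ) * 1)
            + 2 * θ ^ 2 * (entryWeight a ρ s * (if s.2 = true then 1 else 0)) := by
        intro s
        calc _ = entryWeight a ρ s * (1 + 2 * θ ^ 2 * (if s.2 = true then 1 else 0)) *
              ∑ s', entryWeight a ρ s' + 2 * θ ^ 2 * entryWeight a ρ s *
              ∑ s', entryWeight a ρ s' * (if s'.2 = true then 1 else 0) := by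
              rw [Finset.mul_sum, Finset.mul_sum, ← Finset.sum_add_distrib]
              exact Finset.sum_congr rfl fun s' _ => by ring
          _ = _ := by
              rw [sum_entryWeight, sum_entryWeight_mul_ite]
              ring
      rw [Finset.sum_congr rfl fun s _ => e s, Finset.sum_add_distrib, ← Finset.sum_mul,
        ← Finset.mul_sum, sum_entryWeight, sum_entryWeight_mul_ite]
      ring
    _ ≤ _ := by linarith [Real.add_one_le_exp (4 * θ ^ 2 * ρ)]

lemma abs_logTerm_sub_le {L : ℝ} (hlip : ∀ x y : ℝ, |x| ≤ C ^ 2 → |y| ≤ C ^ 2 →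
      |Real.log (f x) - Real.log (f y)| ≤ L * |x - y| ∧
      |Real.log (1 - f x) - Real.log (1 - f y)| ≤ L * |x - y|) (s : Bool × Bool) {x y : ℝ}
    (hx : |x| ≤ C ^ 2) (hy : |y| ≤ C ^ 2) :
    |logTerm f s x - logTerm f s y| ≤ L * (if s.2 = true then 1 else 0) * |x - y| := by
  obtain ⟨h1, h2⟩ := hlip x y hx hy
  unfold logTerm
  split_ifs <;> simp [h1, h2]

/-- The uniform deviation bound for the log-likelihood, as a bound on the total weight of the
outcomes `B` at which the centred log-likelihood ratio is large somewhere. -/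
lemma sum_entryWeight_deviation_le (hC : 0 < C) (hf : LinkRegular C f) {L : ℝ} (hL : 0 < L)
    (hlip : ∀ x y : ℝ, |x| ≤ C ^ 2 → |y| ≤ C ^ 2 →
      |Real.log (f x) - Real.log (f y)| ≤ L * |x - y| ∧
      |Real.log (1 - f x) - Real.log (1 - f y)| ≤ L * |x - y|)
    (hN : 1 ≤ N) (hJ : 1 ≤ J) {n : ℝ} (hn : (N : ℝ) + J ≤ n) (hρ1 : n / (N * J) ≤ 1)
    {Θs : Matrix (Fin N) (Fin K) ℝ} {As : Matrix (Fin J) (Fin K) ℝ} {ds : Fin J → ℝ}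
    (hs : Feasible C Θs As ds) (B : Finset (Fin N × Fin J → Bool × Bool))
    (hB : ∀ s ∈ B, ∃ (Θ : Matrix (Fin N) (Fin K) ℝ) (A : Matrix (Fin J) (Fin K) ℝ)
      (d : Fin J → ℝ), Feasible C Θ A d ∧
      96 * C ^ 2 * L * √(((J : ℝ) + N) / n) * n ≤ ∑ p : Fin N × Fin J,
        ((logTerm f (s p) (d p.2 + A p.2 ⬝ᵥ Θ p.1)
            - logTerm f (s p) (ds p.2 + As p.2 ⬝ᵥ Θs p.1))
          - ∑ s', entryWeight (f (ds p.2 + As p.2 ⬝ᵥ Θs p.1)) (n / (N * J)) s' *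
            (logTerm f s' (d p.2 + A p.2 ⬝ᵥ Θ p.1)
              - logTerm f s' (ds p.2 + As p.2 ⬝ᵥ Θs p.1)))) :
    ∑ s ∈ B, ∏ p, entryWeight (f (ds p.2 + As p.2 ⬝ᵥ Θs p.1)) (n / (N * J)) (s p)
      ≤ 1 / ((N : ℝ) + J) := by
  have hN' : (1 : ℝ) ≤ N := by exact_mod_cast hN
  have hJ' : (1 : ℝ) ≤ J := by exact_mod_cast hJ
  have hn0 : 0 < n := by linarith
  rcases B.eq_empty_or_nonempty with rfl | hne
  · simp only [Finset.sum_empty]; positivity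
  -- One witness per bad outcome makes the index set of the supremum finite.
  choose Θ A d hfeas hdev using fun t : B => hB t.1 t.2
  have : Nonempty B := hne.to_subtype
  set ρ : ℝ := n / (N * J) with hρ
  have hρ0 : 0 ≤ ρ := by positivity
  set xs : Fin N × Fin J → ℝ := fun p => ds p.2 + As p.2 ⬝ᵥ Θs p.1 with hxs
  set x : Fin N × Fin J → B → ℝ := fun p t => d t p.2 + A t p.2 ⬝ᵥ Θ t p.1 with hx
  have hxs' : ∀ p, |xs p| ≤ C ^ 2 := fun p => abs_score_le hC.le hs p.1 p.2
  have hx' : ∀ p t, |x p t| ≤ C ^ 2 := fun p t => abs_score_le hC.le (hfeas t) p.1 p.2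
  -- Chosen so that the `NJ` factors `exp(4θ²ρ)` multiply to `exp(N + J)`, the order of the number
  -- of sign pairs.
  set θ : ℝ := √(((J : ℝ) + N) / n) / 2 with hθ
  have hroot : √(((J : ℝ) + N) / n) ^ 2 = ((J : ℝ) + N) / n := Real.sq_sqrt (by positivity)
  have hθ0 : 0 < θ := by positivity
  have hθ2 : 4 * θ ^ 2 * n = J + N := by
    rw [hθ, div_pow, hroot]
    field_simp
    norm_num
  -- `16 C²` is twice Grothendieck's `8 C²`, for a difference of two score matrices; then `16 C² *
  -- lam * L = θ`.
  set lam : ℝ := θ / (16 * C ^ 2 * L) with hlam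
  have hlam0 : 0 < lam := by positivity
  set q : Fin N × Fin J → Bool × Bool → ℝ := fun p => entryWeight (f (xs p)) ρ with hq
  have ha : ∀ p, 0 ≤ f (xs p) ∧ f (xs p) ≤ 1 := fun p =>
    ⟨(hf.mem_Ioo _ (hxs' p)).1.le, (hf.mem_Ioo _ (hxs' p)).2.le⟩
  have hq0 : ∀ p s, 0 ≤ q p s := fun p s =>
    entryWeight_nonneg (ha p).1 (ha p).2 hρ0 hρ1 s
  have hξ1 : ∀ (p : Fin N × Fin J) (s : Bool × Bool) (y z : ℝ), |y| ≤ C ^ 2 → |z| ≤ C ^ 2 →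
      |lam * (logTerm f s y - logTerm f s z)|
        ≤ lam * L * (if s.2 = true then 1 else 0) * |y - z| := by
    intro p s y z hy hz
    rw [abs_mul, abs_of_pos hlam0, mul_assoc lam, mul_assoc lam]
    exact mul_le_mul_of_nonneg_left (abs_logTerm_sub_le hlip s hy hz) hlam0.le
  have main := exp_iSup_centred_le q hq0 (fun p => sum_entryWeight _ _)
    (fun p s t => lam * (logTerm f s (x p t) - logTerm f s (xs p)))
    (fun s => lam * L * (if s.2 = true then 1 else 0)) (fun p t => x p t - xs p)
    (fun s => by positivity)
    (fun p s t => hξ1 p s _ _ (hx' p t) (hxs' p))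
    (fun p s t t' => by
      rw [← mul_sub, sub_sub_sub_cancel_right, sub_sub_sub_cancel_right]
      exact hξ1 p s _ _ (hx' p t) (hx' p t'))
    (γ := 16 * C ^ 2) (V := Real.exp (4 * θ ^ 2 * ρ))
    (fun E D hD t => by
      have h1 := (sum_mul_score_le hC (hfeas t) hD).1
      have h2 := (sum_mul_score_le hC hs hD).2
      simp only [hx, hxs, mul_sub, Finset.sum_sub_distrib]
      linarith)
    (fun p => by
      refine le_trans (le_of_eq ?_) (sum_entryWeight_cosh_le (ha p).1 (ha p).2 hρ0 hρ1 (θ := θ) ?_)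
      · refine Finset.sum_congr rfl fun s _ => Finset.sum_congr rfl fun s' _ => ?_
        rw [← mul_add, ← mul_assoc (16 * C ^ 2)]
        congr 3
        rw [hlam]
        field_simp
      · rw [hθ, mul_div_cancel₀ _ (two_ne_zero), hroot, div_le_one hn0]
        linarith)
  -- Chernoff: `lam` times the threshold is `12 θ² n = 3(N + J)`, one `N + J` more than the moment
  -- bound `exp(2(N + J))`.
  have lower : Real.exp (3 * ((N : ℝ) + J)) * ∑ s ∈ B, ∏ p, q p (s p)
      ≤ ∑ s : Fin N × Fin J → Bool × Bool, (∏ p, q p (s p)) *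
        Real.exp (⨆ t, ∑ p, (lam * (logTerm f (s p) (x p t) - logTerm f (s p) (xs p))
          - ∑ s', q p s' * (lam * (logTerm f s' (x p t) - logTerm f s' (xs p))))) := by
    rw [Finset.mul_sum]
    have hprod : ∀ s : Fin N × Fin J → Bool × Bool, 0 ≤ ∏ p, q p (s p) := fun s =>
      Finset.prod_nonneg fun p _ => hq0 _ _
    refine (Finset.sum_le_sum fun s hsB => ?_).trans (Finset.sum_le_sum_of_subset_of_nonneg
      (Finset.subset_univ B) fun s _ _ => mul_nonneg (hprod s) (Real.exp_pos _).le)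
    rw [mul_comm]
    refine mul_le_mul_of_nonneg_left (Real.exp_le_exp.2 ?_) (hprod s)
    refine le_trans ?_ (le_ciSup (f := fun t : B => ∑ p,
      (lam * (logTerm f (s p) (x p t) - logTerm f (s p) (xs p))
        - ∑ s', q p s' * (lam * (logTerm f s' (x p t) - logTerm f s' (xs p)))))
      (Set.finite_range _).bddAbove ⟨s, hsB⟩)
    have h := mul_le_mul_of_nonneg_left (hdev ⟨s, hsB⟩) hlam0.le
    refine le_trans (le_of_eq ?_) (h.trans (le_of_eq ?_))
    · have hr : √(((J : ℝ) + N) / n) = 2 * θ := by rw [hθ]; ring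
      rw [hr, add_comm (N : ℝ), ← hθ2, hlam]
      field_simp
      norm_num
    · rw [Finset.mul_sum]
      refine Finset.sum_congr rfl fun p _ => ?_
      rw [mul_sub, Finset.mul_sum]
      congr 1
      exact Finset.sum_congr rfl fun s' _ => by simp only [hq]; ring
  have h1 := lower.trans main
  have hNJ : ((N : ℝ) + J) ≤ Real.exp ((N : ℝ) + J) := by
    linarith [Real.add_one_le_exp ((N : ℝ) + J)]
  have h2 : (2 : ℝ) ^ (Fintype.card (Fin N) + Fintype.card (Fin J)) *
      Real.exp (4 * θ ^ 2 * ρ) ^ (Fintype.card (Fin N) * Fintype.card (Fin J))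
      ≤ Real.exp (2 * ((N : ℝ) + J)) := by
    rw [Fintype.card_fin, Fintype.card_fin, ← Real.exp_nat_mul]
    have e1 : ((N * J : ℕ) : ℝ) * (4 * θ ^ 2 * ρ) = N + J := by
      rw [add_comm (N : ℝ), ← hθ2, hρ]
      push_cast
      field_simp
    rw [e1, two_mul, Real.exp_add (_ + _) (_ + _)]
    refine mul_le_mul_of_nonneg_right ?_ (Real.exp_pos _).le
    calc (2 : ℝ) ^ (N + J) ≤ Real.exp 1 ^ (N + J) := by
          have := Real.add_one_le_exp (1 : ℝ)
          gcongr
          linarith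
      _ = Real.exp ((N : ℝ) + J) := by rw [← Real.exp_nat_mul]; push_cast; ring_nf
  have h3 : Real.exp ((N : ℝ) + J) * ∑ s ∈ B, ∏ p, q p (s p) ≤ 1 := by
    refine le_of_mul_le_mul_left ?_ (Real.exp_pos (2 * ((N : ℝ) + J)))
    rw [← mul_assoc, ← Real.exp_add, mul_one]
    refine le_trans (le_of_eq ?_) (h1.trans h2)
    ring_nf
  rw [le_div_iff₀ (by positivity), mul_comm]
  refine le_trans (mul_le_mul_of_nonneg_right hNJ ?_) h3
  exact Finset.sum_nonneg fun s _ => Finset.prod_nonneg fun p _ => hq0 _ _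

lemma frobenius_norm_sq_scoreMatrix_sub (Θ Θs : Matrix (Fin N) (Fin K) ℝ)
    (A As : Matrix (Fin J) (Fin K) ℝ) (d ds : Fin J → ℝ) :
    ‖scoreMatrix Θ A d - scoreMatrix Θs As ds‖ ^ 2 = ∑ p : Fin N × Fin J,
      ((d p.2 + A p.2 ⬝ᵥ Θ p.1) - (ds p.2 + As p.2 ⬝ᵥ Θs p.1)) ^ 2 := by
  rw [Matrix.frobenius_norm_def, ← Real.sqrt_eq_rpow, Real.sq_sqrt (by positivity),
    Fintype.sum_prod_type]
  simp [scoreMatrix_apply]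

end IFA

end

/-! ### Assembling the theorem -/

theorem theorem3 (C : ℝ) (hC : 0 < C) (f : ℝ → ℝ) (hf : IFA.LinkRegular C f) :
    ∃ C₁ C₂ : ℝ, 0 < C₁ ∧ 0 < C₂ ∧
      ∀ (K N J : ℕ) (n : ℝ), 1 ≤ N → 1 ≤ J → 0 < n →
        ((N : ℝ) + J) * Real.log (J * N) ≤ n →
      ∀ (Θs : Matrix (Fin N) (Fin K) ℝ) (As : Matrix (Fin J) (Fin K) ℝ) (ds : Fin J → ℝ),
        IFA.Feasible C Θs As ds →
      ∀ {Ω : Type*} [MeasurableSpace Ω] (P : Measure Ω) [IsProbabilityMeasure P]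
        (Y W : Fin N → Fin J → Ω → Bool),
        IFA.IsModel f n Θs As ds P Y W →
        (∀ ω, ∃ (Θ : Matrix (Fin N) (Fin K) ℝ) (A : Matrix (Fin J) (Fin K) ℝ) (d : Fin J → ℝ),
          IFA.IsCJMLE C f (fun i j => Y i j ω) (fun i j => W i j ω) Θ A d) ∧
        1 - C₁ / ((N : ℝ) + J) ≤
          P.real {ω | ∀ (Θ : Matrix (Fin N) (Fin K) ℝ) (A : Matrix (Fin J) (Fin K) ℝ)
            (d : Fin J → ℝ),
            IFA.IsCJMLE C f (fun i j => Y i j ω) (fun i j => W i j ω) Θ A d →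
            1 / ((N : ℝ) * J) * ‖IFA.scoreMatrix Θ A d - IFA.scoreMatrix Θs As ds‖ ^ 2 ≤
              C₂ * √(((J : ℝ) + N) / n)} := by
  obtain ⟨L, hL, hlip⟩ := hf.exists_lipschitz
  obtain ⟨c, hc, hkl⟩ := hf.exists_kl_lower_bound
  -- `3` makes the probability bound vacuous when `N + J ≤ 3`; otherwise `JN ≥ 3 > e`, so the
  -- logarithm is at least `1`.
  refine ⟨3, 96 * C ^ 2 * L / c, by norm_num, by positivity, ?_⟩
  intro K N J n hN hJ hn0 hn Θs As ds hs Ω _ P _ Y W hmod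
  refine ⟨fun ω => IFA.exists_isCJMLE hC.le hf _ _ hs, ?_⟩
  have hN' : (1 : ℝ) ≤ N := by exact_mod_cast hN
  have hJ' : (1 : ℝ) ≤ J := by exact_mod_cast hJ
  rcases le_or_gt ((N : ℝ) + J) 3 with hsmall | hlarge
  · refine le_trans ?_ measureReal_nonneg
    rw [sub_nonpos, le_div_iff₀ (by positivity)]
    linarith
  have hn' : (N : ℝ) + J ≤ n := by
    have h3 : (3 : ℝ) ≤ J * N := by
      have h4 : 4 ≤ N + J := by
        have : 3 < N + J := by exact_mod_cast hlarge
        omega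
      have : (4 : ℝ) ≤ N + J := by exact_mod_cast h4
      nlinarith
    have hlog : 1 ≤ Real.log (J * N) := by
      rw [Real.le_log_iff_exp_le (by linarith)]
      linarith [Real.exp_one_lt_d9]
    exact (le_mul_of_one_le_right (by positivity) hlog).trans hn
  have hρ1 : n / (N * J) ≤ 1 := by
    rw [← hmod.prob_W ⟨0, hN⟩ ⟨0, hJ⟩]
    exact measureReal_le_one
  classical
  set good : Set Ω := {ω | ∀ (Θ : Matrix (Fin N) (Fin K) ℝ) (A : Matrix (Fin J) (Fin K) ℝ)
    (d : Fin J → ℝ), IFA.IsCJMLE C f (fun i j => Y i j ω) (fun i j => W i j ω) Θ A d →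
    1 / ((N : ℝ) * J) * ‖IFA.scoreMatrix Θ A d - IFA.scoreMatrix Θs As ds‖ ^ 2 ≤
      96 * C ^ 2 * L / c * √(((J : ℝ) + N) / n)} with hgood
  let B : Finset (Fin N × Fin J → Bool × Bool) := {s | ∃ (Θ : Matrix (Fin N) (Fin K) ℝ)
    (A : Matrix (Fin J) (Fin K) ℝ) (d : Fin J → ℝ),
    IFA.IsCJMLE C f (fun i j => (s (i, j)).1) (fun i j => (s (i, j)).2) Θ A d ∧
    96 * C ^ 2 * L / c * √(((J : ℝ) + N) / n) <
      1 / ((N : ℝ) * J) * ‖IFA.scoreMatrix Θ A d - IFA.scoreMatrix Θs As ds‖ ^ 2}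
  have hdev := IFA.sum_entryWeight_deviation_le hC hf hL hlip hN hJ hn' hρ1 hs B (by
    intro s hsB
    obtain ⟨Θ, A, d, hmle, hbig⟩ := (Finset.mem_filter.1 hsB).2
    refine ⟨Θ, A, d, hmle.1, ?_⟩
    have hlik := hmle.2 Θs As ds hs
    rw [IFA.log_likelihood hC.le hf _ _ hs, IFA.log_likelihood hC.le hf _ _ hmle.1] at hlik
    rw [IFA.frobenius_norm_sq_scoreMatrix_sub, one_div, inv_mul_eq_div, lt_div_iff₀ (by positivity),
      div_mul_eq_mul_div, div_mul_eq_mul_div, div_lt_iff₀ hc] at hbig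
    -- The mean log-likelihood ratio of an entry is the observation probability times minus a
    -- Kullback-Leibler divergence.
    have hexp : ∀ p : Fin N × Fin J, n / (N * J) *
        (c * ((d p.2 + A p.2 ⬝ᵥ Θ p.1) - (ds p.2 + As p.2 ⬝ᵥ Θs p.1)) ^ 2)
        ≤ -∑ s', IFA.entryWeight (f (ds p.2 + As p.2 ⬝ᵥ Θs p.1)) (n / (N * J)) s' *
            (IFA.logTerm f s' (d p.2 + A p.2 ⬝ᵥ Θ p.1)
              - IFA.logTerm f s' (ds p.2 + As p.2 ⬝ᵥ Θs p.1)) := by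
      intro p
      rw [IFA.sum_entryWeight_mul_logTerm, ← mul_neg]
      refine mul_le_mul_of_nonneg_left ?_ (by positivity)
      have := hkl _ _ (IFA.abs_score_le hC.le hmle.1 p.1 p.2) (IFA.abs_score_le hC.le hs p.1 p.2)
      linarith
    have hsum := Finset.sum_le_sum fun p (_ : p ∈ Finset.univ) => hexp p
    rw [Finset.sum_neg_distrib, ← Finset.mul_sum, ← Finset.mul_sum] at hsum
    rw [Finset.sum_sub_distrib, Finset.sum_sub_distrib]
    have hlow : 96 * C ^ 2 * L * √(((J : ℝ) + N) / n) * n ≤ n / (N * J) * (c *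
        ∑ p : Fin N × Fin J,
          ((d p.2 + A p.2 ⬝ᵥ Θ p.1) - (ds p.2 + As p.2 ⬝ᵥ Θs p.1)) ^ 2) := by
      rw [div_mul_eq_mul_div, le_div_iff₀ (by positivity)]
      nlinarith
    linarith)
  have hbad : P.real goodᶜ ≤ 1 / ((N : ℝ) + J) := by
    refine le_trans (measureReal_mono ?_) ((hmod.measureReal_le_sum B).trans hdev)
    intro ω hω
    simp only [hgood, Set.mem_compl_iff, Set.mem_ofPred_eq, not_forall, not_le] at hω
    obtain ⟨Θ, A, d, hmle, hbig⟩ := hω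
    exact Finset.mem_filter.2 ⟨Finset.mem_univ _, Θ, A, d, hmle, hbig⟩
  -- Subadditivity suffices, so measurability of `good` is never required.
  have huniv : 1 ≤ P.real good + P.real goodᶜ := by
    have := measureReal_union_le (μ := P) good goodᶜ
    rwa [Set.union_compl_self, probReal_univ] at this
  have h13 : 1 / ((N : ℝ) + J) ≤ 3 / ((N : ℝ) + J) := by gcongr; norm_num
  linarith
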